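/- **Setting.** Let $X=\mathbb H/G$ be an oriented hyperbolic surface, where $G=\pi_1(X)$ acts on the upper half-plane $\mathbb H$ freely and properly discontinuously through a homomorphism $\rho_X:G\to PSL_2(\mathbb R)$ (the holonomy of the marking). No finiteness of area or topology is required; a finite-area hyperbolic surface with totally geodesic boundary is included through the complete surface $\mathbb H/\pi_1$ that contains it, which has the same fundamental group and the same closed geodesics. Let $x$ be a simple closed geodesic in $X$. For $s\in\mathbb R$, the *left twist deformation* $X_s$ of $X$ at time $s$ along $x$ is the marked hyperbolic surface, with holonomy $\rho_{X_s}:G\to PSL_2(\mathbb R)$, obtained by cutting $X$ along $x$ and regluing with a left twist of distance $s$. Explicitly, there is a map $E$ from the set of components of $\mathbb H\setminus\{\text{lifts of }x\}$ to $PSL_2(\mathbb R)$ such that * if the components $C,C'$ are adjacent along a lift $L$ of $x$, then $E(C)^{-1}E(C')$ is the translation along $L$ by the distance $s$ to the left, as seen from $C$ when facing $L$ (to the right by $|s|$ if $s<0$); * $E(\gamma C)\,\rho_X(\gamma)=\rho_{X_s}(\gamma)\,E(C)$ for all $\gamma\in G$ and all components $C$. Let $y$ be any closed geodesic in $X$ (not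 necessarily simple) whose image differs from that of $x$, and let $p$ be an intersection point of $x$ and $y$, that is, a pair of parameters at which the two closed curves agree. Choose lifts of $x$ and $y$ to $\mathbb H$ that meet over $p$; they are the axes of $\rho_X(a)$ and $\rho_X(b)$ for elements $a,b\in G$ that represent $x$ and $y$. The intersection point of $X_s$ corresponding to $p$ is the one over which the axes of $\rho_{X_s}(a)$ and $\rho_{X_s}(b)$ meet, and $\phi_p(X_s)\in[0,\pi)$ denotes the angle there, measured anticlockwise from the axis of $\rho_{X_s}(b)$ (that is, from $y$) to the axis of $\rho_{X_s}(a)$ (that is, to $x$). **Lemma 2.1 (Kerckhoff).** For every $s\in\mathbb R$ the twist deformation $X_s$ exists as a marked hyperbolic surface, with $G$ acting on $\mathbb H$ through $\rho_{X_s}$ freely and properly discontinuously. For every choice of the surfaces $X_s$, the elements $\rho_{X_s}(a)$ and $\rho_{X_s}(b)$ are hyperbolic, their axes intersect, and the angle $\phi_p(X_s)$ is well defined. The function $s\mapsto\phi_p(X_s)$ is strictly decreasing on $\mathbb R$. -/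

import Mathlib

open scoped UpperHalfPlane MatrixGroups

noncomputable section

/-- The group of orientation-preserving isometries of the hyperbolic plane `ℍ`, realised as the
group of all maps `z ↦ (a z + b) / (c z + d)` with `a d - b c = 1`; it is isomorphic to
`PSL(2, ℝ)`. -/
abbrev IsomPlus : Type := (MulAction.toPermHom SL(2, ℝ) ℍ).range

namespace IsomPlus

/-- The transformation `z ↦ exp r * z`: the translation by the signed distance `r` along the
imaginary axis, towards `∞` when `0 < r`. -/
def translation (r : ℝ) : IsomPlus :=
  ⟨MulAction.toPermHom SL(2, ℝ) ℍ
      ⟨!![Real.exp (r / 2), 0; 0, Real.exp (-(r / 2))], by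
        simp [Matrix.det_fin_two_of, ← Real.exp_add]⟩, ⟨_, rfl⟩⟩

theorem coe_translation_smul (r : ℝ) (z : ℍ) :
    ((translation r • z : ℍ) : ℂ) = (Real.exp r : ℂ) * z := by
  let m : SL(2, ℝ) := ⟨!![Real.exp (r / 2), 0; 0, Real.exp (-(r / 2))], by
    simp [Matrix.det_fin_two_of, ← Real.exp_add]⟩
  have h : translation r • z = m • z := rfl
  have hr : Real.exp r = Real.exp (r / 2) * Real.exp (r / 2) := by
    rw [← Real.exp_add]; congr 1; ring
  rw [h, UpperHalfPlane.coe_specialLinearGroup_apply]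
  simp [m, hr, Complex.exp_neg]
  ring

/-- An orientation-preserving isometry `g` is used as a frame for the oriented complete geodesic
`g (i ℝ_{>0})`, directed from `g 0` to `g ∞`.  This is its unit-speed parametrization
`t ↦ g (i * exp t)`. -/
def line (g : IsomPlus) (t : ℝ) : ℍ := g • (translation t • UpperHalfPlane.I)

/-- The open half-plane to the right of the oriented geodesic `g.line`. -/
def rightSide (g : IsomPlus) : Set ℍ := {z | 0 < (g⁻¹ • z).re}

/-- The open half-plane to the left of the oriented geodesic `g.line`. -/
def leftSide (g : IsomPlus) : Set ℍ := {z | (g⁻¹ • z).re < 0}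

/-- The points `z` and `w` lie strictly on different sides of the geodesic `g.line`. -/
def Separates (g : IsomPlus) (z w : ℍ) : Prop :=
  (z ∈ g.rightSide ∧ w ∈ g.leftSide) ∨ (z ∈ g.leftSide ∧ w ∈ g.rightSide)

end IsomPlus

/-- A complete oriented hyperbolic surface `ℍ / G` marked by the group `G`: the holonomy `hol` of
the marking identifies `G`, the fundamental group, with a group of orientation-preserving
isometries of `ℍ` that acts freely and properly discontinuously. -/
structure HyperbolicSurface (G : Type*) [Group G] where
  hol : G →* IsomPlus
  free : ∀ (γ : G) (z : ℍ), hol γ • z = z → γ = 1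
  properlyDiscontinuous : ∀ K : Set ℍ, IsCompact K → {γ : G | ∃ z ∈ K, hol γ • z ∈ K}.Finite

namespace HyperbolicSurface

variable {G : Type*} [Group G]

/-- A closed oriented geodesic of the surface `ℍ / G`, given by a lift: a complete geodesic of `ℍ`
with its unit-speed parametrization `frame.line`, on which the deck transformation `deck` acts as
the translation by `len`.  The closed geodesic itself is the projection of `frame.line`, a
`len`-periodic curve, and the conjugacy class of `deck` is its free homotopy class. (So `hol deck`
is hyperbolic with translation length `len`, and `frame.line` is its axis.) -/
structure ClosedGeodesic (X : HyperbolicSurface G) where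
  frame : IsomPlus
  deck : G
  len : ℝ
  len_pos : 0 < len
  hol_deck_smul : ∀ t : ℝ, X.hol deck • frame.line t = frame.line (t + len)

namespace ClosedGeodesic

variable {X : HyperbolicSurface G}

/-- A frame of the lift of `x` obtained by moving the chosen lift by `γ`.  All lifts of `x` are of
this form. -/
def lift (x : X.ClosedGeodesic) (γ : G) : IsomPlus := X.hol γ * x.frame

/-- The preimage in `ℍ` of (the image of) the closed geodesic, that is the union of its lifts. -/
def preimage (x : X.ClosedGeodesic) : Set ℍ := {z | ∃ (γ : G) (t : ℝ), z = (x.lift γ).line t}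

/-- The closed geodesic, as a closed curve `ℝ / len ℤ → ℍ / G`, is injective. -/
def IsSimple (x : X.ClosedGeodesic) : Prop :=
  ∀ (γ : G) (t u : ℝ), X.hol γ • x.frame.line t = x.frame.line u → ∃ n : ℤ, u = t + n * x.len

end ClosedGeodesic

/-- `Y` is obtained from `X` by the left twist deformation at time `s` along `x`.

`Y` is glued, with a left twist of distance `s`, from the pieces into which `x` cuts `X`.  On
universal covers: for `z` off the lifts of `x`, `E z` is the isometry by which the piece containing
`z`, a component of the complement of the lifts of `x`, is placed in the universal cover `ℍ` of
`Y`.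
* `E` takes one value on each piece.
* Consider two adjacent pieces, which share the lift `x.lift γ`.  Compared with the placement of
  the piece on the right of this lift, the piece on its left is moved by the translation of signed
  distance `-s` along the lift.  For `0 < s` this is a slide by the distance `s` to the left, for
  an observer on the right-hand piece who faces the lift.  (Exchanging the roles of the two pieces,
  or reversing the orientation of the lift, gives the same condition.)
* The gluing is compatible with the markings: the piece `γ • C` is placed by the deck
  transformation `γ` of `Y` where the piece `C` is placed. -/
def IsLeftTwist {X : HyperbolicSurface G} (x : X.ClosedGeodesic) (s : ℝ)
    (Y : HyperbolicSurface G) : Prop :=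
  ∃ E : ℍ → IsomPlus,
    (∀ z w : ℍ, z ∉ x.preimage → w ∉ x.preimage →
      (∀ γ : G, ¬ (x.lift γ).Separates z w) → E z = E w) ∧
    (∀ (γ : G) (z w : ℍ), z ∉ x.preimage → w ∉ x.preimage →
      z ∈ (x.lift γ).rightSide → w ∈ (x.lift γ).leftSide →
      (∀ δ : G, (x.lift δ).Separates z w →
        Set.range (x.lift δ).line = Set.range (x.lift γ).line) →
      (E z)⁻¹ * E w = x.lift γ * IsomPlus.translation (-s) * (x.lift γ)⁻¹) ∧
    (∀ (γ : G) (z : ℍ), z ∉ x.preimage → E (X.hol γ • z) * X.hol γ = Y.hol γ * E z)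

/-- The angle in `[0, π)` at `g.line t = h.line u`, measured anticlockwise from the unoriented
geodesic `h.line` to the unoriented geodesic `g.line`.  (The upper half-plane is a conformal
model, so the argument of the quotient of the velocities in `ℂ` is the hyperbolic angle.) -/
def anticlockwiseAngle (g : IsomPlus) (t : ℝ) (h : IsomPlus) (u : ℝ) : ℝ :=
  toIcoMod Real.pi_pos 0
    (Complex.arg (deriv (fun r : ℝ => (g.line r : ℂ)) t / deriv (fun r : ℝ => (h.line r : ℂ)) u))

/-- An intersection point of the closed geodesics `x` and `y`: parameters at which the two curves
in `ℍ / G` agree, with the unique deck transformation which exhibits this.  The lift `x.lift γ` of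
`x` and the lift `y.frame` of `y` then meet at a point of `ℍ` over the intersection point. -/
structure IntersectionPoint {X : HyperbolicSurface G} (x y : X.ClosedGeodesic) where
  timeX : ℝ
  timeY : ℝ
  γ : G
  meet : (x.lift γ).line timeX = y.frame.line timeY

/-- `θ` is the angle, anticlockwise from `y` to `x`, at the intersection point of the marked
surface `Y` that corresponds to `p`.  The lifts of `x` and `y` through (a lift of) `p` are the axes
of `p.γ * x.deck * p.γ⁻¹` and of `y.deck`; the corresponding intersection point in `Y` is where the
axes in `Y` of the same two elements of the fundamental group `G` meet. -/
def IntersectionPoint.HasAngle {X : HyperbolicSurface G} {x y : X.ClosedGeodesic}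
    (p : IntersectionPoint x y) (Y : HyperbolicSurface G) (θ : ℝ) : Prop :=
  ∃ x' y' : Y.ClosedGeodesic, x'.deck = p.γ * x.deck * p.γ⁻¹ ∧ y'.deck = y.deck ∧
    ∃ t u : ℝ, x'.frame.line t = y'.frame.line u ∧
      θ = anticlockwiseAngle x'.frame t y'.frame u

end HyperbolicSurface

end

/-!
Fix a simple closed geodesic `x`, and write `shear s g` for the translation by `s` along the geodesic
of the frame `g`.

**Existence of the twist.**  The lifts of `x` are disjoint geodesics of `ℍ` with distances bounded from
below, and the half-planes they bound form a nested family in which any two points are separated by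
finitely many members (`WallSpace`).  The displacement of the piece of `w` relative to the piece of
`z` is the ordered product of the translations along the lifts that separate `z` from `w`.  This is a
cocycle (`WallSpace.cocycle_mul`): of three points, each half-plane separates at most one from the two
others.  The cocycle is equivariant, hence it defines a homomorphism `twistHol`.  By `dist_shears`, a
product of translations along a chain of uniformly separated geodesics cannot bring a point beyond the
chain much closer, so proper discontinuity is inherited from the original action.  Consequently an
element with a fixed point in the twisted action has finite order; then it also fixes a point in the
original action, and is trivial.  Conversely, in every twist deformation the relative displacements
are given by the same cocycle (`exists_placement`), because any two points can be joined by crossing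
one lift at a time.

**Monotonicity of the angle.**  Two disjoint, non-asymptotic geodesics with compatible orientations
have frames which differ by a matrix with positive entries (`Before`).  Along one period of `y`,
starting just beyond its intersection with the lift `g` of `x`, the lifts crossed by `y` form a chain
`g, g m₁, g m₁ m₂, …` with positive matrices `mᵢ` whose last member is the translate of `g` by the
deck transformation of `y`.  The product of the translations along the chain telescopes, and in the
coordinates of `g` the deck transformation of `y` in the twisted surface becomes
`m₁ τ(s) m₂ τ(s) ⋯ mₙ τ(s)`, where `τ(s)` is the diagonal matrix of the translation by `s`
(`exists_positive_word`).  This matrix is positive.  Hence it is hyperbolic, with a fixed point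
`P > 0` and a fixed point `-M < 0`; its axis crosses the imaginary axis, which is the axis of `x` in
these coordinates, and the angle there is `2 arctan √(M / P)`.  Positive matrices act on `(0, ∞)` by
increasing functions and `τ(s)` is the multiplication by `exp s`, so `P` increases strictly with `s`;
the same argument for the inverse, acting on the negative numbers, shows that `M` does not increase.
-/

noncomputable section

namespace IsomPlus

/-! ### Isometries as Möbius transformations -/

/-- The isometry `z ↦ (a z + b) / (c z + d)` given by a matrix; this is the projection
`SL(2, ℝ) → PSL(2, ℝ)`. -/
def moebius : SL(2, ℝ) →* IsomPlus := (MulAction.toPermHom SL(2, ℝ) ℍ).rangeRestrict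

theorem moebius_smul (m : SL(2, ℝ)) (z : ℍ) : moebius m • z = m • z := rfl

theorem moebius_surjective : Function.Surjective moebius :=
  MonoidHom.rangeRestrict_surjective _

theorem smul_ext {g h : IsomPlus} (H : ∀ z : ℍ, g • z = h • z) : g = h :=
  Subtype.ext (Equiv.ext H)

theorem moebius_neg (m : SL(2, ℝ)) : moebius (-m) = moebius m := by
  refine smul_ext fun z => UpperHalfPlane.ext ?_
  simp only [moebius_smul, UpperHalfPlane.coe_specialLinearGroup_apply]
  have h1 : -(((m 0 0 : ℝ) : ℂ) * z) + -((m 0 1 : ℝ) : ℂ) = -((m 0 0 : ℝ) * z + (m 0 1 : ℝ)) := by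
    ring
  have h2 : -(((m 1 0 : ℝ) : ℂ) * z) + -((m 1 1 : ℝ) : ℂ) = -((m 1 0 : ℝ) * z + (m 1 1 : ℝ)) := by
    ring
  simp only [Matrix.SpecialLinearGroup.coe_neg, Matrix.neg_apply, Algebra.algebraMap_self,
    RingHom.id_apply, Complex.ofReal_neg, neg_mul, h1, h2, neg_div_neg_eq]

theorem det_eq (m : SL(2, ℝ)) : m 0 0 * m 1 1 - m 0 1 * m 1 0 = 1 := by
  rw [← Matrix.det_fin_two]; exact m.2

/-- The squared modulus of the denominator `c z + d`. -/
def denomSq (m : SL(2, ℝ)) (z : ℍ) : ℝ := (m 1 0 * z.re + m 1 1) ^ 2 + (m 1 0 * z.im) ^ 2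

theorem denomSq_pos (m : SL(2, ℝ)) (z : ℍ) : 0 < denomSq m z := by
  unfold denomSq
  by_contra! h
  have h1 : m 1 0 * z.im = 0 :=
      by nlinarith [sq_nonneg (m 1 0 * z.re + m 1 1), sq_nonneg (m 1 0 * z.im)]
  have hc : m 1 0 = 0 := by simpa [z.im_pos.ne'] using h1
  have hd : m 1 1 = 0 := by rw [hc] at h; nlinarith [sq_nonneg (m 1 1)]
  have := det_eq m
  rw [hc, hd] at this; norm_num at this

theorem moebius_smul_re (m : SL(2, ℝ)) (z : ℍ) : (moebius m • z).re =
    (m 0 0 * m 1 0 * (z.re ^ 2 + z.im ^ 2) + m 0 1 * m 1 1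
      + (m 0 0 * m 1 1 + m 0 1 * m 1 0) * z.re) / denomSq m z := by
  rw [moebius_smul, ← UpperHalfPlane.coe_re, UpperHalfPlane.coe_specialLinearGroup_apply]
  simp [Complex.div_re, Complex.normSq_apply, denomSq]
  rw [← add_div]
  congr 1 <;> ring

theorem moebius_smul_im (m : SL(2, ℝ)) (z : ℍ) :
    (moebius m • z).im = z.im / denomSq m z := by
  rw [moebius_smul, ← UpperHalfPlane.coe_im, UpperHalfPlane.coe_specialLinearGroup_apply]
  simp [Complex.div_im, Complex.normSq_apply, denomSq]
  rw [← sub_div]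
  congr 1
  · linear_combination (z.im) * det_eq m
  · ring

/-- The matrix with rows `(a, b)` and `(c, d)`. -/
def mat (a b c d : ℝ) (h : a * d - b * c = 1) : SL(2, ℝ) :=
  ⟨!![a, b; c, d], by rw [Matrix.det_fin_two_of]; exact h⟩

section entries

variable (a b c d : ℝ) (h : a * d - b * c = 1)

@[simp] theorem mat_zero_zero : mat a b c d h 0 0 = a := rfl
@[simp] theorem mat_zero_one : mat a b c d h 0 1 = b := rfl
@[simp] theorem mat_one_zero : mat a b c d h 1 0 = c := rfl
@[simp] theorem mat_one_one : mat a b c d h 1 1 = d := rfl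

end entries

theorem mul_apply (m n : SL(2, ℝ)) (i j : Fin 2) :
    (m * n) i j = m i 0 * n 0 j + m i 1 * n 1 j := by
  rw [Matrix.SpecialLinearGroup.coe_mul, Matrix.mul_apply, Fin.sum_univ_two]

theorem inv_apply (m : SL(2, ℝ)) :
    (m⁻¹ 0 0 = m 1 1 ∧ m⁻¹ 0 1 = -m 0 1) ∧ m⁻¹ 1 0 = -m 1 0 ∧ m⁻¹ 1 1 = m 0 0 := by
  simp [Matrix.SpecialLinearGroup.coe_inv, Matrix.adjugate_fin_two]

theorem neg_apply (m : SL(2, ℝ)) (i j : Fin 2) : (-m) i j = -m i j := by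
  rw [Matrix.SpecialLinearGroup.coe_neg, Matrix.neg_apply]

theorem sl_ext {m n : SL(2, ℝ)} (h₁ : m 0 0 = n 0 0) (h₂ : m 0 1 = n 0 1) (h₃ : m 1 0 = n 1 0)
    (h₄ : m 1 1 = n 1 1) : m = n := by
  apply Matrix.SpecialLinearGroup.ext
  intro i j
  fin_cases i <;> fin_cases j <;> assumption

/-! ### Translations, geodesics and half-planes -/

/-- The diagonal matrix that induces the translation by `r` along the imaginary axis. -/
def diag (r : ℝ) : SL(2, ℝ) :=
  mat (Real.exp (r / 2)) 0 0 (Real.exp (-(r / 2))) (by simp [← Real.exp_add])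

theorem translation_eq (r : ℝ) : translation r = moebius (diag r) := rfl

theorem diag_add (r t : ℝ) : diag (r + t) = diag r * diag t := by
  apply sl_ext <;> simp only [mul_apply] <;> simp [diag, ← Real.exp_add, add_div, add_comm]

theorem translation_add (r t : ℝ) : translation (r + t) = translation r * translation t := by
  rw [translation_eq, diag_add, map_mul]; rfl

@[simp] theorem translation_zero : translation 0 = 1 := by
  have h := translation_add 0 0
  rw [add_zero] at h
  exact (mul_eq_left.mp h.symm)

theorem translation_neg (r : ℝ) : translation (-r) = (translation r)⁻¹ := by
  rw [eq_inv_iff_mul_eq_one, ← translation_add]; simp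

theorem translation_comm (r t : ℝ) : translation r * translation t =
    translation t * translation r := by
  rw [← translation_add, ← translation_add, add_comm]

theorem translation_zpow (r : ℝ) (n : ℤ) : translation r ^ n = translation (n * r) := by
  induction n with
  | zero => simp
  | succ n ih => rw [zpow_add_one, ih, ← translation_add]; push_cast; ring_nf
  | pred n ih => rw [zpow_sub_one, ih, ← translation_neg, ← translation_add]; push_cast; ring_nf

theorem translation_smul_I_re (t : ℝ) : (translation t • UpperHalfPlane.I).re = 0 := by
  rw [← UpperHalfPlane.coe_re, coe_translation_smul]; simp [Complex.exp_ofReal_re]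

theorem translation_smul_I_im (t : ℝ) : (translation t • UpperHalfPlane.I).im = Real.exp t := by
  rw [← UpperHalfPlane.coe_im, coe_translation_smul]; simp [Complex.exp_ofReal_re]

theorem dist_smul (g : IsomPlus) (z w : ℍ) : dist (g • z) (g • w) = dist z w := by
  obtain ⟨m, rfl⟩ := moebius_surjective g
  exact _root_.dist_smul m z w

theorem smul_line (g h : IsomPlus) (t : ℝ) : g • h.line t = (g * h).line t := by
  simp [line, mul_smul]

theorem mul_translation_line (g : IsomPlus) (r t : ℝ) :
    (g * translation r).line t = g.line (r + t) := by
  rw [line, line, translation_add]; simp [mul_smul]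

theorem dist_line (g : IsomPlus) (t u : ℝ) : dist (g.line t) (g.line u) = |t - u| := by
  rw [line, line, dist_smul, UpperHalfPlane.dist_of_re_eq]
  · simp [translation_smul_I_im, Real.dist_eq]
  · simp [translation_smul_I_re]

theorem continuous_smul (g : IsomPlus) : Continuous fun z : ℍ => g • z :=
  (Isometry.of_dist_eq fun z w => dist_smul g z w).continuous

theorem continuous_line (g : IsomPlus) : Continuous g.line :=
  (Isometry.of_dist_eq fun t u => by rw [dist_line, Real.dist_eq]).continuous

/-- The half-turn `z ↦ -1 / z` about `i`; `g * halfTurn` is a frame for the geodesic `g.line` with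
the opposite orientation. -/
def halfTurn : IsomPlus := moebius (mat 0 (-1) 1 0 (by norm_num))

theorem halfTurn_mul_halfTurn : halfTurn * halfTurn = 1 := by
  have : mat 0 (-1) 1 0 (by norm_num) * mat 0 (-1) 1 0 (by norm_num) = -1 := by
    apply sl_ext <;> simp [mul_apply, neg_apply]
  rw [halfTurn, ← map_mul, this, moebius_neg, map_one]

theorem halfTurn_inv : halfTurn⁻¹ = halfTurn := inv_eq_of_mul_eq_one_left halfTurn_mul_halfTurn

theorem translation_mul_halfTurn (t : ℝ) :
    translation t * halfTurn = halfTurn * translation (-t) := by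
  rw [translation_eq, translation_eq, halfTurn, ← map_mul, ← map_mul]
  congr 1
  apply sl_ext <;> simp only [mul_apply] <;> simp [diag, neg_div]

theorem halfTurn_smul_re (z : ℍ) :
    (halfTurn • z).re = -z.re / (z.re ^ 2 + z.im ^ 2) := by
  rw [halfTurn, moebius_smul_re]; simp [denomSq]

theorem halfTurn_smul_I : halfTurn • UpperHalfPlane.I = UpperHalfPlane.I := by
  apply UpperHalfPlane.ext
  rw [halfTurn, moebius_smul, UpperHalfPlane.coe_specialLinearGroup_apply]
  simp

theorem mul_halfTurn_line (g : IsomPlus) (t : ℝ) : (g * halfTurn).line t = g.line (-t) := by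
  rw [line, line, mul_smul, ← mul_smul halfTurn]
  have := translation_mul_halfTurn (-t)
  rw [neg_neg] at this
  rw [← this, mul_smul, halfTurn_smul_I]

theorem mem_rightSide {g : IsomPlus} {z : ℍ} : z ∈ g.rightSide ↔ 0 < (g⁻¹ • z).re := Iff.rfl

theorem mem_leftSide {g : IsomPlus} {z : ℍ} : z ∈ g.leftSide ↔ (g⁻¹ • z).re < 0 := Iff.rfl

theorem rightSide_mul_halfTurn (g : IsomPlus) : (g * halfTurn).rightSide = g.leftSide := by
  ext z
  have : 0 < (g⁻¹ • z).re ^ 2 + (g⁻¹ • z).im ^ 2 := by have := (g⁻¹ • z).im_pos; positivity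
  rw [mem_rightSide, mem_leftSide, mul_inv_rev, halfTurn_inv, mul_smul, halfTurn_smul_re,
    lt_div_iff₀ this]
  simp

theorem leftSide_mul_halfTurn (g : IsomPlus) : (g * halfTurn).leftSide = g.rightSide := by
  rw [← rightSide_mul_halfTurn, mul_assoc, halfTurn_mul_halfTurn, mul_one]

theorem translation_smul_re (r : ℝ) (z : ℍ) :
    (translation r • z).re = Real.exp r * z.re := by
  rw [← UpperHalfPlane.coe_re, coe_translation_smul]; simp [Complex.exp_ofReal_re]

theorem rightSide_mul_translation (g : IsomPlus) (r : ℝ) :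
    (g * translation r).rightSide = g.rightSide := by
  ext z
  rw [mem_rightSide, mem_rightSide, mul_inv_rev, ← translation_neg, mul_smul, translation_smul_re]
  simp [Real.exp_pos]

theorem leftSide_mul_translation (g : IsomPlus) (r : ℝ) :
    (g * translation r).leftSide = g.leftSide := by
  ext z
  rw [mem_leftSide, mem_leftSide, mul_inv_rev, ← translation_neg, mul_smul, translation_smul_re]
  simp [Real.exp_pos, mul_neg_iff, (Real.exp_pos _).not_gt]

theorem smul_mem_rightSide (k g : IsomPlus) (z : ℍ) :
    k • z ∈ (k * g).rightSide ↔ z ∈ g.rightSide := by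
  rw [mem_rightSide, mem_rightSide, mul_inv_rev, ← mul_smul, inv_mul_cancel_right]

theorem smul_mem_leftSide (k g : IsomPlus) (z : ℍ) :
    k • z ∈ (k * g).leftSide ↔ z ∈ g.leftSide := by
  rw [mem_leftSide, mem_leftSide, mul_inv_rev, ← mul_smul, inv_mul_cancel_right]

/-- A point lies on the geodesic `g.line` exactly when it lies on neither side of it. -/
theorem mem_range_line {g : IsomPlus} {z : ℍ} :
    z ∈ Set.range g.line ↔ (g⁻¹ • z).re = 0 := by
  constructor
  · rintro ⟨t, rfl⟩
    rw [line, ← mul_smul, inv_mul_cancel, one_smul, translation_smul_I_re]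
  · intro h
    refine ⟨Real.log (g⁻¹ • z).im, ?_⟩
    rw [line]
    have : translation (Real.log (g⁻¹ • z).im) • UpperHalfPlane.I = g⁻¹ • z := by
      apply UpperHalfPlane.ext_re_im
      · rw [translation_smul_I_re, h]
      · rw [translation_smul_I_im, Real.exp_log (UpperHalfPlane.im_pos _)]
    rw [this, smul_inv_smul]

theorem mem_line_or_side (g : IsomPlus) (z : ℍ) :
    z ∈ Set.range g.line ∨ z ∈ g.leftSide ∨ z ∈ g.rightSide := by
  rw [mem_range_line, mem_leftSide, mem_rightSide]
  rcases lt_trichotomy (g⁻¹ • z).re 0 with h | h | h <;> simp [h]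

theorem notMem_leftSide_of_mem_rightSide {g : IsomPlus} {z : ℍ} (h : z ∈ g.rightSide) :
    z ∉ g.leftSide := by
  rw [mem_rightSide] at h; rw [mem_leftSide]; linarith

theorem range_line_mul_translation (g : IsomPlus) (r : ℝ) :
    Set.range (g * translation r).line = Set.range g.line := by
  ext z
  rw [mem_range_line, mem_range_line, mul_inv_rev, ← translation_neg, mul_smul, translation_smul_re]
  simp

theorem range_line_mul_halfTurn (g : IsomPlus) :
    Set.range (g * halfTurn).line = Set.range g.line := by
  ext z
  have : z ∈ Set.range (g * halfTurn).line ↔ z ∉ g.leftSide ∧ z ∉ g.rightSide := by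
    rw [← rightSide_mul_halfTurn g, ← leftSide_mul_halfTurn g, mem_range_line, mem_leftSide,
      mem_rightSide, not_lt, not_lt]
    exact ⟨fun h => ⟨h.le, h.ge⟩, fun h => le_antisymm h.1 h.2⟩
  rw [this, mem_range_line, mem_leftSide, mem_rightSide, not_lt, not_lt]
  exact ⟨fun h => le_antisymm h.2 h.1, fun h => by simp [h]⟩

/-- The geodesic given by a matrix crosses the imaginary axis where
`a c exp (2 t) + b d` vanishes. -/
theorem moebius_line_re (m : SL(2, ℝ)) (t : ℝ) : ((moebius m).line t).re =
    (m 0 0 * m 1 0 * Real.exp t ^ 2 + m 0 1 * m 1 1) /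
      denomSq m (translation t • UpperHalfPlane.I) := by
  rw [line, moebius_smul_re, translation_smul_I_re, translation_smul_I_im]
  simp

theorem moebius_line_im (m : SL(2, ℝ)) (t : ℝ) : ((moebius m).line t).im =
    Real.exp t / denomSq m (translation t • UpperHalfPlane.I) := by
  rw [line, moebius_smul_im, translation_smul_I_im]

end IsomPlus

namespace IsomPlus

/-! ### Geodesics through two points and crossings of geodesics -/

/-- A rotation about `i` that takes `w` to the imaginary axis exists by the intermediate value
theorem: the real parts of the images of `w` under the rotations by `0` and by the half-turn have
opposite signs. -/
theorem exists_line_through_I (w : ℍ) :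
    ∃ (k : IsomPlus) (t : ℝ), k • UpperHalfPlane.I = UpperHalfPlane.I ∧ k.line t = w := by
  let F : ℝ → ℝ := fun θ => Real.cos θ * Real.sin θ * (w.re ^ 2 + w.im ^ 2)
    + (-Real.sin θ) * Real.cos θ + (Real.cos θ * Real.cos θ + (-Real.sin θ) * Real.sin θ) * w.re
  have hF : Continuous F := by fun_prop
  have h0 : F 0 = w.re := by simp [F]
  have h1 : F (Real.pi / 2) = -w.re := by simp [F]
  have hz : ∃ θ, F θ = 0 := by
    rcases le_total 0 w.re with h | h
    · exact mem_range_of_exists_le_of_exists_ge hF ⟨Real.pi / 2, by rw [h1]; linarith⟩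
        ⟨0, by rw [h0]; exact h⟩
    · exact mem_range_of_exists_le_of_exists_ge hF ⟨0, by rw [h0]; exact h⟩
        ⟨Real.pi / 2, by rw [h1]; linarith⟩
  obtain ⟨θ, hθ⟩ := hz
  have hdet : Real.cos θ * Real.cos θ - (-Real.sin θ) * Real.sin θ = 1 := by
    have := Real.sin_sq_add_cos_sq θ; linarith
  let m := mat (Real.cos θ) (-Real.sin θ) (Real.sin θ) (Real.cos θ) hdet
  have hre : (moebius m • w).re = 0 := by
    rw [moebius_smul_re]
    simp only [m, mat_zero_zero, mat_zero_one, mat_one_zero, mat_one_one]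
    rw [div_eq_zero_iff]; left; exact hθ
  have hI : moebius m • UpperHalfPlane.I = UpperHalfPlane.I := by
    have hd : denomSq m UpperHalfPlane.I = 1 := by
      simp only [denomSq, m, mat_one_zero, mat_one_one, UpperHalfPlane.I_re, UpperHalfPlane.I_im]
      linarith
    apply UpperHalfPlane.ext_re_im
    · rw [moebius_smul_re, hd]; simp [m]; ring
    · rw [moebius_smul_im, hd]; simp
  have := mem_range_line (g := (moebius m)⁻¹) (z := w)
  rw [inv_inv] at this
  obtain ⟨t, ht⟩ := this.2 hre
  exact ⟨(moebius m)⁻¹, t, by rw [inv_smul_eq_iff, hI], ht⟩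

/-- Any two points lie on a geodesic, at the parameters `0` and their distance. -/
theorem exists_line_through (z w : ℍ) :
    ∃ k : IsomPlus, k.line 0 = z ∧ k.line (dist z w) = w := by
  obtain ⟨k₀, hk₀⟩ : ∃ k₀ : IsomPlus, k₀ • UpperHalfPlane.I = z :=
    ⟨moebius z.toSL2R, UpperHalfPlane.toSL2R_smul_I z⟩
  obtain ⟨k, t, hk, ht⟩ := exists_line_through_I (k₀⁻¹ • w)
  have h0 : (k₀ * k).line 0 = z := by simp [line, mul_smul, hk, hk₀]
  have h1 : (k₀ * k).line t = w := by rw [← smul_line, ht, smul_inv_smul]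
  have hd : dist z w = |t| := by rw [← h0, ← h1, dist_line]; simp
  rcases le_total 0 t with h | h
  · exact ⟨k₀ * k, h0, by rw [hd, abs_of_nonneg h, h1]⟩
  · exact ⟨k₀ * k * halfTurn, by rw [mul_halfTurn_line, neg_zero, h0],
      by rw [mul_halfTurn_line, hd, abs_of_nonpos h, neg_neg, h1]⟩

theorem line_mem_rightSide_moebius (g : IsomPlus) (m : SL(2, ℝ)) (t : ℝ) :
    (g * moebius m).line t ∈ g.rightSide ↔
      0 < m 0 0 * m 1 0 * Real.exp t ^ 2 + m 0 1 * m 1 1 := by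
  rw [mem_rightSide, smul_line, inv_mul_cancel_left, moebius_line_re,
    lt_div_iff₀ (denomSq_pos _ _), zero_mul]

theorem line_mem_leftSide_moebius (g : IsomPlus) (m : SL(2, ℝ)) (t : ℝ) :
    (g * moebius m).line t ∈ g.leftSide ↔
      m 0 0 * m 1 0 * Real.exp t ^ 2 + m 0 1 * m 1 1 < 0 := by
  rw [mem_leftSide, smul_line, inv_mul_cancel_left, moebius_line_re,
    div_lt_iff₀ (denomSq_pos _ _), zero_mul]

theorem line_mem_range_moebius (g : IsomPlus) (m : SL(2, ℝ)) (t : ℝ) :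
    (g * moebius m).line t ∈ Set.range g.line ↔
      m 0 0 * m 1 0 * Real.exp t ^ 2 + m 0 1 * m 1 1 = 0 := by
  rw [mem_range_line, smul_line, inv_mul_cancel_left, moebius_line_re,
    div_eq_zero_iff, or_iff_left (denomSq_pos _ _).ne']

theorem exists_eq_mul_moebius (g k : IsomPlus) : ∃ m : SL(2, ℝ), k = g * moebius m := by
  obtain ⟨m, hm⟩ := moebius_surjective (g⁻¹ * k)
  exact ⟨m, by rw [hm, mul_inv_cancel_left]⟩

theorem exists_translation_of_diagonal {m : SL(2, ℝ)} (hb : m 0 1 = 0) (hc : m 1 0 = 0) :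
    ∃ r, moebius m = translation r := by
  wlog ha : 0 < m 0 0 generalizing m
  · have hd := det_eq m
    rw [hb, hc] at hd
    have hne : m 0 0 ≠ 0 := fun h => by rw [h] at hd; norm_num at hd
    have := @this (-m) (by rw [neg_apply, hb, neg_zero]) (by rw [neg_apply, hc, neg_zero])
      (by rw [neg_apply]; rcases lt_or_gt_of_ne hne with h | h
          · linarith
          · exact absurd h ha)
    rwa [moebius_neg] at this
  have hd := det_eq m
  rw [hb, hc] at hd
  refine ⟨2 * Real.log (m 0 0), ?_⟩
  rw [translation_eq]
  congr 1
  have h1 : Real.exp (2 * Real.log (m 0 0) / 2) = m 0 0 := by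
    rw [mul_div_cancel_left₀ _ two_ne_zero, Real.exp_log ha]
  apply sl_ext <;> simp only [diag, mat_zero_zero, mat_zero_one, mat_one_zero, mat_one_one]
  · rw [h1]
  · exact hb
  · exact hc
  · rw [Real.exp_neg, h1]; field_simp; linarith

/-- The two frames belong to the same geodesic, with the same or with the opposite orientation. -/
def SameLine (g k : IsomPlus) : Prop :=
  ∃ r, k = g * translation r ∨ k = g * halfTurn * translation r

/-- Two geodesics that meet either coincide or cross exactly once, from one side to the other. -/
theorem sameLine_or_crossing {g k : IsomPlus} {t : ℝ} (h : k.line t ∈ Set.range g.line) :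
    SameLine g k ∨
      (∀ u, (u < t → k.line u ∈ g.leftSide) ∧ (t < u → k.line u ∈ g.rightSide)) ∨
      (∀ u, (u < t → k.line u ∈ g.rightSide) ∧ (t < u → k.line u ∈ g.leftSide)) := by
  obtain ⟨m, rfl⟩ := exists_eq_mul_moebius g k
  simp only [line_mem_rightSide_moebius, line_mem_leftSide_moebius]
  rw [line_mem_range_moebius] at h
  have hd := det_eq m
  have hmono : ∀ u v : ℝ, u < v → Real.exp u ^ 2 < Real.exp v ^ 2 := fun u v huv => by
    have := Real.exp_lt_exp.2 huv
    have := Real.exp_pos u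
    gcongr
  rcases lt_trichotomy (m 0 0 * m 1 0) 0 with h0 | h0 | h0
  · right; right
    exact fun u => ⟨fun hu => by nlinarith [hmono _ _ hu], fun hu => by nlinarith [hmono _ _ hu]⟩
  · left
    rw [h0] at h
    have h1 : m 0 1 * m 1 1 = 0 := by linarith
    rcases mul_eq_zero.1 h0 with ha | hc
    · have hb : m 0 1 ≠ 0 := fun hb => by rw [ha, hb] at hd; norm_num at hd
      have hdd : m 1 1 = 0 := (mul_eq_zero.1 h1).resolve_left hb
      obtain ⟨r, hr⟩ := exists_translation_of_diagonal
        (m := mat 0 (-1) 1 0 (by norm_num) * m) (by simp [mul_apply, hdd]) (by simp [mul_apply, ha])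
      refine ⟨r, Or.inr ?_⟩
      rw [← hr, map_mul, mul_assoc, show moebius (mat 0 (-1) 1 0 (by norm_num)) = halfTurn from rfl,
        ← mul_assoc halfTurn, halfTurn_mul_halfTurn, one_mul]
    · have hdd : m 1 1 ≠ 0 := fun hb => by rw [hc, hb] at hd; norm_num at hd
      have hb : m 0 1 = 0 := (mul_eq_zero.1 h1).resolve_right hdd
      obtain ⟨r, hr⟩ := exists_translation_of_diagonal hb hc
      exact ⟨r, Or.inl (by rw [hr])⟩
  · right; left
    exact fun u => ⟨fun hu => by nlinarith [hmono _ _ hu], fun hu => by nlinarith [hmono _ _ hu]⟩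

theorem continuous_line_re (g k : IsomPlus) : Continuous fun t => (g⁻¹ • k.line t).re := by
  have h1 := (continuous_smul g⁻¹).comp k.continuous_line
  exact UpperHalfPlane.continuous_re.comp h1

theorem notMem_range_of_mem_leftSide {g : IsomPlus} {z : ℍ} (h : z ∈ g.leftSide) :
    z ∉ Set.range g.line := by
  rw [mem_range_line]; exact ne_of_lt h

theorem notMem_range_of_mem_rightSide {g : IsomPlus} {z : ℍ} (h : z ∈ g.rightSide) :
    z ∉ Set.range g.line := by
  rw [mem_range_line]; exact ne_of_gt h

theorem SameLine.range_eq {g k : IsomPlus} (h : SameLine g k) :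
    Set.range k.line = Set.range g.line := by
  obtain ⟨r, rfl | rfl⟩ := h
  · rw [range_line_mul_translation]
  · rw [range_line_mul_translation, range_line_mul_halfTurn]

/-- A geodesic that passes from the left to the right of another one crosses it exactly once. -/
theorem exists_crossing {g k : IsomPlus} {t u : ℝ} (htu : t < u) (ht : k.line t ∈ g.leftSide)
    (hu : k.line u ∈ g.rightSide) :
    ∃ v, t < v ∧ v < u ∧ k.line v ∈ Set.range g.line ∧
      ∀ w, (w < v → k.line w ∈ g.leftSide) ∧ (v < w → k.line w ∈ g.rightSide) := by
  obtain ⟨v, ⟨hv1, hv2⟩, hv⟩ := intermediate_value_Icc htu.le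
    (continuous_line_re g k).continuousOn
    (show (0 : ℝ) ∈ Set.Icc _ _ from ⟨le_of_lt ht, le_of_lt hu⟩)
  have hvr : k.line v ∈ Set.range g.line := mem_range_line.2 hv
  have htv : t < v := lt_of_le_of_ne hv1 (by
    rintro rfl; exact notMem_range_of_mem_leftSide ht hvr)
  have hvu : v < u := lt_of_le_of_ne hv2 (by
    rintro rfl; exact notMem_range_of_mem_rightSide hu hvr)
  refine ⟨v, htv, hvu, hvr, ?_⟩
  rcases sameLine_or_crossing hvr with h | h | h
  · exact absurd (h.range_eq ▸ ⟨t, rfl⟩) (notMem_range_of_mem_leftSide ht)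
  · exact h
  · exact absurd ((h t).1 htv) (fun h' => notMem_leftSide_of_mem_rightSide h' ht)

/-- A geodesic that does not meet another one stays on one side of it. -/
theorem line_side_of_disjoint {g k : IsomPlus} (h : ∀ t, k.line t ∉ Set.range g.line) :
    (∀ t, k.line t ∈ g.leftSide) ∨ ∀ t, k.line t ∈ g.rightSide := by
  by_contra! H
  obtain ⟨⟨t, ht⟩, u, hu⟩ := H
  have ht' := ((mem_line_or_side g (k.line t)).resolve_left (h t)).resolve_left ht
  have hu' := ((mem_line_or_side g (k.line u)).resolve_left (h u)).resolve_right hu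
  have := mem_range_of_exists_le_of_exists_ge (continuous_line_re g k) ⟨u, le_of_lt hu'⟩
    ⟨t, le_of_lt ht'⟩
  obtain ⟨v, hv⟩ := this
  exact h v (mem_range_line.2 hv)

/-! ### Nested half-planes and positive matrices -/

/-- All entries of the matrix are positive. -/
def Pos (m : SL(2, ℝ)) : Prop := 0 < m 0 0 ∧ 0 < m 0 1 ∧ 0 < m 1 0 ∧ 0 < m 1 1

theorem Pos.mul {m n : SL(2, ℝ)} (hm : Pos m) (hn : Pos n) : Pos (m * n) := by
  obtain ⟨a, b, c, d⟩ := hm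
  obtain ⟨a', b', c', d'⟩ := hn
  refine ⟨?_, ?_, ?_, ?_⟩ <;> rw [mul_apply] <;> positivity

theorem Pos.mul_diag {m : SL(2, ℝ)} (hm : Pos m) (r : ℝ) : Pos (m * diag r) := by
  obtain ⟨a, b, c, d⟩ := hm
  refine ⟨?_, ?_, ?_, ?_⟩ <;> rw [mul_apply] <;> simp [diag] <;> positivity

theorem Pos.diag_mul {m : SL(2, ℝ)} (hm : Pos m) (r : ℝ) : Pos (diag r * m) := by
  obtain ⟨a, b, c, d⟩ := hm
  refine ⟨?_, ?_, ?_, ?_⟩ <;> rw [mul_apply] <;> simp [diag] <;> positivity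

/-- The frame `k` is obtained from the frame `g` by a matrix with positive entries. As such a
matrix maps `[0, ∞]` into `(0, ∞)`, the closed half-plane to the right of `k.line` is contained in
the open half-plane to the right of `g.line`, and the geodesics are not asymptotic. -/
def Before (g k : IsomPlus) : Prop := ∃ m, Pos m ∧ k = g * moebius m

theorem Before.mem_rightSide {g k : IsomPlus} (h : Before g k) {z : ℍ} (hz : z ∉ k.leftSide) :
    z ∈ g.rightSide := by
  obtain ⟨m, ⟨a, b, c, d⟩, rfl⟩ := h
  set w := (g * moebius m)⁻¹ • z with hw
  have hz' : z = (g * moebius m) • w := by rw [hw, smul_inv_smul]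
  rw [mem_leftSide, not_lt, ← hw] at hz
  rw [IsomPlus.mem_rightSide, hz', mul_smul, inv_smul_smul, moebius_smul_re]
  apply div_pos _ (denomSq_pos _ _)
  have := w.im_pos
  positivity

theorem Before.mem_leftSide {g k : IsomPlus} (h : Before g k) {z : ℍ} (hz : z ∉ g.rightSide) :
    z ∈ k.leftSide := by
  by_contra h'
  exact hz (h.mem_rightSide h')

theorem pos_or_pos_neg {m : SL(2, ℝ)} (h1 : 0 < m 0 0 * m 1 0) (h2 : 0 < m 0 1 * m 1 1)
    (h3 : 0 < m 1 1 * m 1 0) : Pos m ∨ Pos (-m) := by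
  rcases lt_or_ge 0 (m 1 0) with h | h
  · left
    have hd : 0 < m 1 1 := by by_contra!; nlinarith
    refine ⟨?_, ?_, h, hd⟩
    · by_contra!; nlinarith
    · by_contra!; nlinarith
  · right
    have hc : m 1 0 < 0 := lt_of_le_of_ne h (by rintro h; rw [h] at h1; simp at h1)
    have hd : m 1 1 < 0 := by by_contra!; nlinarith
    refine ⟨?_, ?_, ?_, ?_⟩ <;> rw [neg_apply] <;> rw [neg_pos]
    · by_contra!; nlinarith
    · by_contra!; nlinarith
    · exact hc
    · exact hd

/-- The distance to the imaginary axis is at most `|re z| / im z`. -/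
theorem dist_vertical_le (z : ℍ) :
    dist z ((1 : IsomPlus).line (Real.log z.im)) ≤ |z.re| / z.im := by
  have him : ((1 : IsomPlus).line (Real.log z.im)).im = z.im := by
    rw [line, one_smul, translation_smul_I_im, Real.exp_log z.im_pos]
  have hre : ((1 : IsomPlus).line (Real.log z.im)).re = 0 := by
    rw [line, one_smul, translation_smul_I_re]
  refine (UpperHalfPlane.dist_le_dist_coe_div_sqrt _ _).trans ?_
  rw [him, Real.sqrt_mul_self z.im_pos.le, Complex.dist_eq]
  have : ((z : ℂ) - ((1 : IsomPlus).line (Real.log z.im) : ℂ)) = (z.re : ℂ) := by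
    apply Complex.ext
    · simp [hre]
    · simp [him]
  rw [this, Complex.norm_real, Real.norm_eq_abs]

/-- The positivity of the two coefficients is read off for large and for small `exp t`. -/
theorem pos_of_forall_mul_exp_le {p q δ : ℝ} (hδ : 0 < δ)
    (h : ∀ t : ℝ, δ * Real.exp t ≤ p * Real.exp t ^ 2 + q) : 0 < p ∧ 0 < q := by
  constructor
  · by_contra! hp
    have h1 := h (Real.log (|q| / δ + 1))
    have hpos : 0 < |q| / δ + 1 := by positivity
    rw [Real.exp_log hpos] at h1
    have h2 : δ * (|q| / δ + 1) = |q| + δ := by field_simp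
    nlinarith [le_abs_self q, sq_nonneg (|q| / δ + 1)]
  · by_contra! hq
    have h1 := h (Real.log (δ / (|p| + 1) / 2))
    have hpos : 0 < δ / (|p| + 1) / 2 := by positivity
    rw [Real.exp_log hpos] at h1
    set y := δ / (|p| + 1) / 2 with hy
    have h2 : δ = 2 * y * (|p| + 1) := by rw [hy]; field_simp
    have h3 : p * y ^ 2 ≤ |p| * y ^ 2 := by gcongr; exact le_abs_self p
    have h4 : 0 ≤ |p| * y ^ 2 := by positivity
    have h5 : 0 < y ^ 2 := by positivity
    have h6 : δ * y = 2 * (|p| * y ^ 2) + 2 * y ^ 2 := by rw [h2]; ring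
    nlinarith

/-- Two geodesics at positive distance, each on the appropriate side of the other one, are related
by a positive matrix. The signs of the products `a c` and `b d` of the entries come from the real
parts of the points of `k.line` in the coordinates of `g`; those of `c d` and `a b` come from
exchanging the two geodesics. -/
theorem before_of_dist {g k : IsomPlus} {δ : ℝ} (hδ : 0 < δ)
    (hdist : ∀ t u, δ ≤ dist (g.line t) (k.line u)) (hk : ∃ t, k.line t ∈ g.rightSide)
    (hg : ∃ t, g.line t ∈ k.leftSide) : Before g k := by
  have hk' : ∀ t, k.line t ∈ g.rightSide := by
    obtain ⟨t, ht⟩ := hk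
    refine (line_side_of_disjoint fun u hu => ?_).resolve_left
      (fun h => notMem_leftSide_of_mem_rightSide ht (h t))
    obtain ⟨v, hv⟩ := hu
    have := hdist v u
    rw [hv, dist_self] at this
    linarith
  have hg' : ∀ t, g.line t ∈ k.leftSide := by
    obtain ⟨t, ht⟩ := hg
    refine (line_side_of_disjoint fun u hu => ?_).resolve_right
      (fun h => notMem_leftSide_of_mem_rightSide (h t) ht)
    obtain ⟨v, hv⟩ := hu
    have := hdist u v
    rw [hv, dist_self] at this
    linarith
  obtain ⟨m, rfl⟩ := exists_eq_mul_moebius g k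
  have key : ∀ (n : SL(2, ℝ)) (t : ℝ),
      (∀ u, δ ≤ dist ((1 : IsomPlus).line u) ((moebius n).line t)) →
      δ * Real.exp t ≤ |n 0 0 * n 1 0 * Real.exp t ^ 2 + n 0 1 * n 1 1| := by
    intro n t hn
    have h1 := (hn _).trans ((dist_comm _ _).trans_le (dist_vertical_le ((moebius n).line t)))
    have hN := denomSq_pos n (translation t • UpperHalfPlane.I)
    rw [moebius_line_re, moebius_line_im, abs_div, abs_of_pos hN, div_div_div_cancel_right₀ hN.ne',
      le_div_iff₀ (Real.exp_pos t)] at h1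
    exact h1
  have h1 : 0 < m 0 0 * m 1 0 ∧ 0 < m 0 1 * m 1 1 := by
    refine pos_of_forall_mul_exp_le hδ fun t => ?_
    have := key m t (fun u => by
      rw [← dist_smul g, smul_line, smul_line, mul_one]; exact hdist u t)
    rwa [abs_of_pos] at this
    exact (line_mem_rightSide_moebius g m t).1 (hk' t)
  obtain ⟨⟨i1, i2⟩, i3, i4⟩ := inv_apply m
  have h2 : 0 < m 1 1 * m 1 0 ∧ 0 < m 0 1 * m 0 0 := by
    refine pos_of_forall_mul_exp_le hδ fun t => ?_
    have := key m⁻¹ t (fun u => by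
      rw [← dist_smul (g * moebius m), smul_line, smul_line, mul_one, map_inv, mul_inv_cancel_right,
        dist_comm]
      exact hdist t u)
    have hl := (line_mem_leftSide_moebius (g * moebius m) m⁻¹ t).1 (by
      rw [map_inv, mul_inv_cancel_right]; exact hg' t)
    rw [abs_of_neg hl, i1, i2, i3, i4] at this
    linarith
  rcases pos_or_pos_neg h1.1 h1.2 h2.1 with h | h
  · exact ⟨m, h, rfl⟩
  · exact ⟨-m, h, by rw [moebius_neg]⟩

/-! ### Axes of translations, and elements of finite order -/

/-- The projection `SL(2, ℝ) → PSL(2, ℝ)` has kernel `{1, -1}`, and a nontrivial isometry does not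
fix a geodesic pointwise. -/
theorem eq_one_or_eq_neg_one_of_fixes_line {m : SL(2, ℝ)}
    (h : ∀ t, (moebius m).line t = (1 : IsomPlus).line t) : m = 1 ∨ m = -1 := by
  have hN : ∀ t, m 1 0 ^ 2 * Real.exp t ^ 2 + m 1 1 ^ 2 = 1 := fun t => by
    have h1 := congrArg UpperHalfPlane.im (h t)
    rw [moebius_line_im, line, one_smul, translation_smul_I_im,
      div_eq_iff (denomSq_pos _ _).ne', denomSq, translation_smul_I_re,
      translation_smul_I_im] at h1
    have h2 := mul_left_cancel₀ (Real.exp_ne_zero t) ((mul_one _).trans h1)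
    linarith
  have hre : ∀ t, m 0 0 * m 1 0 * Real.exp t ^ 2 + m 0 1 * m 1 1 = 0 := fun t => by
    have h1 := congrArg UpperHalfPlane.re (h t)
    rw [moebius_line_re, line, one_smul, translation_smul_I_re, div_eq_zero_iff,
      or_iff_left (denomSq_pos _ _).ne'] at h1
    exact h1
  have n0 := hN 0
  have n1 := hN (Real.log 2)
  have r0 := hre 0
  rw [Real.exp_zero] at n0 r0
  rw [Real.exp_log two_pos] at n1
  have hc : m 1 0 = 0 := by
    have : m 1 0 ^ 2 = 0 := by linarith
    simpa using this
  rw [hc] at n0 r0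
  have hd : (m 1 1 - 1) * (m 1 1 + 1) = 0 := by linarith
  have hdet := det_eq m
  rw [hc] at hdet
  rcases mul_eq_zero.1 hd with hd | hd
  · left
    have hd' : m 1 1 = 1 := by linarith
    rw [hd'] at hdet r0
    apply sl_ext <;> simp <;> linarith
  · right
    have hd' : m 1 1 = -1 := by linarith
    rw [hd'] at hdet r0
    apply sl_ext <;> simp [neg_apply] <;> linarith

theorem eq_one_of_fixes_line {g : IsomPlus} (h : ∀ t, g.line t = (1 : IsomPlus).line t) : g = 1 :=
    by
  obtain ⟨m, rfl⟩ := moebius_surjective g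
  rcases eq_one_or_eq_neg_one_of_fixes_line h with rfl | rfl
  · exact map_one _
  · rw [moebius_neg, map_one]

theorem eq_or_eq_neg_of_moebius_eq {m n : SL(2, ℝ)} (h : moebius m = moebius n) :
    m = n ∨ m = -n := by
  have h1 : moebius (n⁻¹ * m) = 1 := by rw [map_mul, map_inv, h, inv_mul_cancel]
  rcases eq_one_or_eq_neg_one_of_fixes_line (fun t => by rw [h1] : ∀ t, _ = _) with h2 | h2
  · exact Or.inl (inv_mul_eq_one.1 h2).symm
  · right
    rw [← mul_inv_cancel_left n m, h2]
    simp

/-- An isometry is determined by its values on a geodesic. -/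
theorem eq_of_line_eq {g h : IsomPlus} (H : ∀ t, g.line t = h.line t) : g = h := by
  have : h⁻¹ * g = 1 := eq_one_of_fixes_line fun t => by
    rw [← smul_line, H t, smul_line, inv_mul_cancel]
  exact (inv_mul_eq_one.1 this).symm

/-- An isometry of finite order has a fixed point. If the trace `τ` of a matrix `m` satisfies
`|τ| < 2`, the fixed point is the root in `ℍ` of a quadratic equation. Otherwise the coefficients
in `m ^ k = u k * m - u (k - 1)`, for which `u (k + 1) = τ * u k - u (k - 1)`, grow in absolute
value and do not vanish for `1 ≤ k`; so if a power of `m` is `1` or `-1`, then `m` itself is a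
scalar matrix. -/
theorem exists_fixed_of_pow_eq_one {g : IsomPlus} {n : ℕ} (hn : 0 < n) (h : g ^ n = 1) :
    ∃ z : ℍ, g • z = z := by
  obtain ⟨m, rfl⟩ := moebius_surjective g
  have hd := det_eq m
  by_cases htr : 4 ≤ (m 0 0 + m 1 1) ^ 2
  · set τ := m 0 0 + m 1 1 with hτ
    have hrec : ∀ k : ℕ, ∃ u v : ℝ, 1 ≤ |u| - |v| ∧
        (m ^ (k + 1)) 0 0 = u * m 0 0 - v ∧ (m ^ (k + 1)) 0 1 = u * m 0 1 ∧
        (m ^ (k + 1)) 1 0 = u * m 1 0 ∧ (m ^ (k + 1)) 1 1 = u * m 1 1 - v := by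
      intro k
      induction k with
      | zero => exact ⟨1, 0, by simp⟩
      | succ k ih =>
        obtain ⟨u, v, huv, e1, e2, e3, e4⟩ := ih
        refine ⟨τ * u - v, u, ?_, ?_, ?_, ?_, ?_⟩
        · have h2 : 2 ≤ |τ| := by
            rw [← abs_of_nonneg (zero_le_two (α := ℝ))]
            exact sq_le_sq.1 (by linarith)
          have h3 : |τ * u| - |v| ≤ |τ * u - v| := abs_sub_abs_le_abs_sub _ _
          rw [abs_mul] at h3
          nlinarith [abs_nonneg u, abs_nonneg v]
        all_goals rw [pow_succ, mul_apply]
        · rw [e1, e2, hτ]; linear_combination (-u) * hd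
        · rw [e1, e2, hτ]; ring
        · rw [e3, e4, hτ]; ring
        · rw [e3, e4, hτ]; linear_combination (-u) * hd
    obtain ⟨k, rfl⟩ : ∃ k, n = k + 1 := ⟨n - 1, by omega⟩
    obtain ⟨u, v, huv, e1, e2, e3, e4⟩ := hrec k
    have hu : u ≠ 0 := by
      rintro rfl
      rw [abs_zero] at huv
      linarith [abs_nonneg v]
    have hpow : m ^ (k + 1) = 1 ∨ m ^ (k + 1) = -1 := by
      apply eq_or_eq_neg_of_moebius_eq
      rw [map_pow, h, map_one]
    have hzero : m 0 1 = 0 ∧ m 1 0 = 0 ∧ m 0 0 = m 1 1 := by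
      have : u * m 0 1 = 0 ∧ u * m 1 0 = 0 ∧ u * m 0 0 - v = u * m 1 1 - v := by
        rw [← e1, ← e2, ← e3, ← e4]
        rcases hpow with hp | hp <;> rw [hp] <;> simp [neg_apply]
      obtain ⟨h1, h2, h3⟩ := this
      exact ⟨(mul_eq_zero.1 h1).resolve_left hu, (mul_eq_zero.1 h2).resolve_left hu,
        mul_left_cancel₀ hu (by linarith)⟩
    obtain ⟨h1, h2, h3⟩ := hzero
    refine ⟨UpperHalfPlane.I, ?_⟩
    rw [h1, h2, h3] at hd
    have hN : denomSq m UpperHalfPlane.I = 1 := by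
      simp only [denomSq, h2, UpperHalfPlane.I_re, UpperHalfPlane.I_im]; linarith
    apply UpperHalfPlane.ext_re_im
    · rw [moebius_smul_re, hN]; simp [h1, h2]
    · rw [moebius_smul_im, hN]; simp
  · have hc : m 1 0 ≠ 0 := by
      intro hc
      rw [hc] at hd
      nlinarith [sq_nonneg (m 0 0 - m 1 1)]
    have hD : 0 < 4 - (m 0 0 + m 1 1) ^ 2 := by linarith
    have hcp : 0 < |m 1 0| := abs_pos.2 hc
    set y := √(4 - (m 0 0 + m 1 1) ^ 2) / (2 * |m 1 0|) with hy
    have hyp : 0 < y := by positivity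
    have hy2 : (m 1 0) ^ 2 * y ^ 2 = (4 - (m 0 0 + m 1 1) ^ 2) / 4 := by
      rw [hy, div_pow, Real.sq_sqrt hD.le, mul_pow, sq_abs]; field_simp; norm_num
    have hx : m 1 0 * ((m 0 0 - m 1 1) / (2 * m 1 0)) = (m 0 0 - m 1 1) / 2 := by field_simp
    set x := (m 0 0 - m 1 1) / (2 * m 1 0) with hxdef
    refine ⟨⟨⟨x, y⟩, hyp⟩, ?_⟩
    have hN : denomSq m ⟨⟨x, y⟩, hyp⟩ = 1 := by
      have e : denomSq m ⟨⟨x, y⟩, hyp⟩ = (m 1 0 * x + m 1 1) ^ 2 + (m 1 0) ^ 2 * y ^ 2 := by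
        simp [denomSq, mul_pow]
      rw [e, hx, hy2]; ring
    apply UpperHalfPlane.ext_re_im
    · rw [moebius_smul_re, hN, div_one]
      show m 0 0 * m 1 0 * (x ^ 2 + y ^ 2) + m 0 1 * m 1 1
        + (m 0 0 * m 1 1 + m 0 1 * m 1 0) * x = x
      apply mul_left_cancel₀ hc
      have hx2 : (m 1 0) ^ 2 * x ^ 2 = ((m 0 0 - m 1 1) / 2) ^ 2 := by rw [← hx]; ring
      linear_combination (m 0 0) * hx2 + (m 0 0) * hy2
        + (m 0 0 * m 1 1 + m 0 1 * m 1 0 - 1) * hx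
        + (-(m 0 0 + m 1 1) / 2) * hd
    · rw [moebius_smul_im, hN, div_one]

/-- The axis of a hyperbolic isometry is unique, up to the choice of its base point. -/
theorem eq_mul_translation_of_conj {k l : IsomPlus} {r r' : ℝ} (hr : 0 < r) (hr' : 0 < r')
    (h : k * translation r * k⁻¹ = l * translation r' * l⁻¹) :
    ∃ v, l = k * translation v := by
  obtain ⟨m, rfl⟩ := exists_eq_mul_moebius k l
  have h1 : translation r * moebius m = moebius m * translation r' := by
    rw [mul_inv_rev] at h
    calc translation r * moebius m = k⁻¹ * (k * translation r * k⁻¹) * (k * moebius m) := by group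
      _ = _ := by rw [h]; group
  have h3 : diag r * m = m * diag r' ∨ diag r * m = -(m * diag r') := by
    rw [translation_eq, translation_eq, ← map_mul, ← map_mul] at h1
    exact eq_or_eq_neg_of_moebius_eq h1
  have hlt1 : Real.exp (-(r / 2)) < 1 := by rw [Real.exp_lt_one_iff]; linarith
  have hlt2 : 1 < Real.exp (r / 2) := by rw [Real.one_lt_exp_iff]; linarith
  have hlt1' : Real.exp (-(r' / 2)) < 1 := by rw [Real.exp_lt_one_iff]; linarith
  have hlt2' : 1 < Real.exp (r' / 2) := by rw [Real.one_lt_exp_iff]; linarith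
  have hp := Real.exp_pos (-(r / 2))
  have hp' := Real.exp_pos (-(r' / 2))
  have hbc : m 0 1 = 0 ∧ m 1 0 = 0 := by
    rcases h3 with h3 | h3
    · have e1 := congrArg (fun n : SL(2, ℝ) => n 0 1) h3
      have e2 := congrArg (fun n : SL(2, ℝ) => n 1 0) h3
      simp only [mul_apply] at e1 e2
      simp [diag] at e1 e2
      constructor
      · have : (Real.exp (r / 2) - Real.exp (-(r' / 2))) * m 0 1 = 0 := by linarith
        exact (mul_eq_zero.1 this).resolve_left (by linarith)
      · have : (Real.exp (-(r / 2)) - Real.exp (r' / 2)) * m 1 0 = 0 := by linarith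
        exact (mul_eq_zero.1 this).resolve_left (by linarith)
    · have e1 := congrArg (fun n : SL(2, ℝ) => n 0 1) h3
      have e2 := congrArg (fun n : SL(2, ℝ) => n 1 0) h3
      simp only [mul_apply, neg_apply] at e1 e2
      simp [diag] at e1 e2
      constructor
      · have : (Real.exp (r / 2) + Real.exp (-(r' / 2))) * m 0 1 = 0 := by linarith
        exact (mul_eq_zero.1 this).resolve_left (by linarith)
      · have : (Real.exp (-(r / 2)) + Real.exp (r' / 2)) * m 1 0 = 0 := by linarith
        exact (mul_eq_zero.1 this).resolve_left (by linarith)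
  obtain ⟨v, hv⟩ := exists_translation_of_diagonal hbc.1 hbc.2
  exact ⟨v, by rw [hv]⟩

end IsomPlus

/-! ### Cocycles of nested families of half-spaces -/

/-- A family of half-spaces of a set `P`: it is closed under complements, any two of its members are
nested up to complements, and any two points are separated by finitely many of them. -/
structure WallSpace (P : Type*) where
  halfSpaces : Set (Set P)
  compl_mem : ∀ H ∈ halfSpaces, Hᶜ ∈ halfSpaces
  nested : ∀ H ∈ halfSpaces, ∀ K ∈ halfSpaces, H ⊆ K ∨ K ⊆ H ∨ H ∩ K = ∅ ∨ H ∪ K = Set.univ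
  finite_sep : ∀ z w, {H ∈ halfSpaces | z ∈ H ∧ w ∉ H}.Finite

namespace WallSpace

variable {P : Type*} (W : WallSpace P)

/-- The half-spaces that contain `z` and not `w`. -/
def sep (z w : P) : Set (Set P) := {H ∈ W.halfSpaces | z ∈ H ∧ w ∉ H}

variable {W}

theorem sep_isChain {z w : P} {H K : Set P} (hH : H ∈ W.sep z w) (hK : K ∈ W.sep z w) :
    H ⊆ K ∨ K ⊆ H := by
  rcases W.nested H hH.1 K hK.1 with h | h | h | h
  · exact Or.inl h
  · exact Or.inr h
  · exact absurd (h.subset ⟨hH.2.1, hK.2.1⟩) (Set.notMem_empty z)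
  · rcases h.superset (Set.mem_univ w) with h | h
    · exact absurd h hH.2.2
    · exact absurd h hK.2.2

theorem compl_mem_sep {z w : P} {H : Set P} (h : H ∈ W.sep z w) : Hᶜ ∈ W.sep w z :=
  ⟨W.compl_mem H h.1, h.2.2, fun h' => h' h.2.1⟩

/-- The list enumerates the set, in strictly increasing order. -/
def Enumerates (l : List (Set P)) (S : Set (Set P)) : Prop :=
  l.Pairwise (· ⊂ ·) ∧ ∀ H, H ∈ l ↔ H ∈ S

theorem Enumerates.unique {l l' : List (Set P)} {S : Set (Set P)} (h : Enumerates l S)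
    (h' : Enumerates l' S) : l = l' := by
  have hn : l.Nodup := h.1.imp fun h => h.ne
  have hn' : l'.Nodup := h'.1.imp fun h => h.ne
  have hp : l.Perm l' := (List.perm_ext_iff_of_nodup hn hn').2 fun H => by rw [h.2, h'.2]
  exact hp.eq_of_pairwise
      (fun a b _ _ hab hba => absurd (hab.trans hba) (ssubset_irrefl a)) h.1 h'.1

theorem exists_enumerates {S : Set (Set P)} (hf : S.Finite)
    (hc : ∀ H ∈ S, ∀ K ∈ S, H ⊆ K ∨ K ⊆ H) : ∃ l, Enumerates l S := by
  induction hn : S.ncard generalizing S with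
  | zero =>
    rw [Set.ncard_eq_zero hf] at hn
    exact ⟨[], List.Pairwise.nil, by simp [hn]⟩
  | succ n ih =>
    have hne : S.Nonempty := by
      rw [Set.nonempty_iff_ne_empty]; rintro rfl; simp at hn
    obtain ⟨M, hM⟩ := hf.exists_maximal hne
    obtain ⟨l, hl1, hl2⟩ := ih (S := S \ {M}) hf.sdiff
      (fun H hH K hK => hc H hH.1 K hK.1) (by
        rw [Set.ncard_sdiff_singleton_of_mem hM.1, hn]; rfl)
    refine ⟨l ++ [M], List.pairwise_append.2 ⟨hl1, by simp, ?_⟩, fun H => ?_⟩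
    · intro K hK M' hM'
      rw [List.mem_singleton] at hM'
      subst hM'
      obtain ⟨hKS, hKM⟩ := (hl2 K).1 hK
      refine LE.le.ssubset_of_ne ?_ hKM
      rcases hc K hKS M' hM.1 with h | h
      · exact h
      · exact hM.2 hKS h
    · rw [List.mem_append, hl2, List.mem_singleton]
      constructor
      · rintro (h | rfl)
        · exact h.1
        · exact hM.1
      · intro h
        by_cases hHM : H = M
        · exact Or.inr hHM
        · exact Or.inl ⟨h, hHM⟩

/-- Concatenation of enumerations. -/
theorem Enumerates.append {l l' : List (Set P)} {S S' : Set (Set P)} (h : Enumerates l S)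
    (h' : Enumerates l' S') (hlt : ∀ H ∈ S, ∀ K ∈ S', H ⊂ K) : Enumerates (l ++ l') (S ∪ S') := by
  refine ⟨List.pairwise_append.2 ⟨h.1, h'.1, fun H hH K hK =>
    hlt H ((h.2 H).1 hH) K ((h'.2 K).1 hK)⟩, fun H => ?_⟩
  rw [List.mem_append, h.2, h'.2]; rfl

/-- Taking complements reverses an enumeration. -/
theorem Enumerates.compl {l : List (Set P)} {S : Set (Set P)} (h : Enumerates l S) :
    Enumerates (l.map compl).reverse {H | Hᶜ ∈ S} := by
  refine ⟨?_, fun H => ?_⟩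
  · rw [List.pairwise_reverse, List.pairwise_map]
    exact h.1.imp fun hab => compl_lt_compl_iff_lt.2 hab
  · rw [List.mem_reverse, List.mem_map]
    constructor
    · rintro ⟨K, hK, rfl⟩
      simpa using (h.2 K).1 hK
    · intro hH
      exact ⟨Hᶜ, (h.2 _).2 hH, compl_compl H⟩

variable (W)

theorem exists_sepList (z w : P) : ∃ l, Enumerates l (W.sep z w) :=
  exists_enumerates (W.finite_sep z w) fun _ hH _ hK => sep_isChain hH hK

/-- The half-spaces that contain `z` and not `w`, in increasing order; this is the order in which a
path from `z` to `w` leaves them. -/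
def sepList (z w : P) : List (Set P) := (W.exists_sepList z w).choose

theorem enumerates_sepList (z w : P) : Enumerates (W.sepList z w) (W.sep z w) :=
  (W.exists_sepList z w).choose_spec

variable {Γ : Type*} [Group Γ] (T : Set P → Γ)

/-- The ordered product of the elements `T H` over the half-spaces that are left on the way from
`z` to `w`. -/
def cocycle (z w : P) : Γ := ((W.sepList z w).map T).prod

variable {W T}

theorem cocycle_eq {z w : P} {l : List (Set P)} (h : Enumerates l (W.sep z w)) :
    W.cocycle T z w = (l.map T).prod := by
  rw [cocycle, (W.enumerates_sepList z w).unique h]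

theorem prod_map_compl {l : List (Set P)} (hT : ∀ H ∈ l, T Hᶜ = (T H)⁻¹) :
    (((l.map compl).reverse).map T).prod = ((l.map T).prod)⁻¹ := by
  induction l with
  | nil => simp
  | cons H l ih =>
    simp only [List.map_cons, List.reverse_cons, List.map_append, List.prod_append, List.map_nil,
      List.prod_cons, List.prod_nil, mul_one, mul_inv_rev]
    rw [ih fun K hK => hT K (List.mem_cons_of_mem H hK), hT H List.mem_cons_self]

/-- Of the half-spaces left on the way from `z` to `w`, those that do not contain `v` are left
first. -/
theorem enumerates_tripod {z w v : P} {l l' : List (Set P)}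
    (h : Enumerates l (W.sep z w ∩ W.sep z v)) (h' : Enumerates l' (W.sep z w ∩ W.sep v w)) :
    Enumerates (l ++ l') (W.sep z w) := by
  have := h.append h' (fun H hH K hK => by
    have hsub : H ⊆ K ∨ K ⊆ H := sep_isChain hH.1 hK.1
    rcases hsub with h1 | h1
    · exact LE.le.ssubset_of_ne h1 fun h2 => hH.2.2.2 (h2 ▸ hK.2.2.1)
    · exact absurd (h1 hK.2.2.1) hH.2.2.2)
  convert this using 1
  ext H
  constructor
  · intro hH
    by_cases hv : v ∈ H
    · exact Or.inr ⟨hH, hH.1, hv, hH.2.2⟩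
    · exact Or.inl ⟨hH, hH.1, hH.2.1, hv⟩
  · rintro (hH | hH) <;> exact hH.1

/-- The cocycle identity: the half-spaces that separate a point from the two other ones contribute
to both sides, or cancel. -/
theorem cocycle_mul (hT : ∀ H ∈ W.halfSpaces, T Hᶜ = (T H)⁻¹) (z w v : P) :
    W.cocycle T z w * W.cocycle T w v = W.cocycle T z v := by
  have hex : ∀ a b c d : P, ∃ l, Enumerates l (W.sep a b ∩ W.sep c d) := fun a b c d =>
    exists_enumerates ((W.finite_sep a b).inter_of_left _) fun _ hH _ hK =>
      sep_isChain hH.1 hK.1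
  obtain ⟨A, hA⟩ := hex z w z v
  obtain ⟨B, hB⟩ := hex z w v w
  obtain ⟨C, hC⟩ := hex z v w v
  have hB' : Enumerates (B.map compl).reverse (W.sep w v ∩ W.sep w z) := by
    convert hB.compl using 1
    ext H
    constructor
    · exact fun h => ⟨compl_mem_sep h.2, compl_mem_sep h.1⟩
    · rintro ⟨h1, h2⟩
      have h1' := compl_mem_sep h1
      have h2' := compl_mem_sep h2
      rw [compl_compl] at h1' h2'
      exact ⟨h2', h1'⟩
  have hA' : Enumerates A (W.sep z v ∩ W.sep z w) := by rwa [Set.inter_comm]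
  have hC' : Enumerates C (W.sep w v ∩ W.sep z v) := by rwa [Set.inter_comm]
  rw [cocycle_eq (enumerates_tripod hA hB), cocycle_eq (enumerates_tripod hB' hC'),
    cocycle_eq (enumerates_tripod hA' hC), List.map_append, List.map_append, List.map_append,
    List.prod_append, List.prod_append, List.prod_append,
    prod_map_compl fun H hH => hT H ((hB.2 H).1 hH).1.1]
  group

theorem cocycle_self (z : P) : W.cocycle T z z = 1 := by
  rw [cocycle_eq (l := []) ⟨List.Pairwise.nil, fun H => by
    simp only [List.not_mem_nil, false_iff]; exact fun h => h.2.2 h.2.1⟩]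
  simp

/-- Equivariance under a symmetry of the family of half-spaces. -/
theorem cocycle_map (e : P ≃ P) (φ : Γ →* Γ)
    (he : ∀ H, e '' H ∈ W.halfSpaces ↔ H ∈ W.halfSpaces)
    (hφ : ∀ H ∈ W.halfSpaces, T (e '' H) = φ (T H)) (z w : P) :
    W.cocycle T (e z) (e w) = φ (W.cocycle T z w) := by
  obtain ⟨l, hl⟩ := W.exists_sepList z w
  have hl' : Enumerates (l.map (e '' ·)) (W.sep (e z) (e w)) := by
    refine ⟨?_, fun H => ?_⟩
    · rw [List.pairwise_map]
      exact hl.1.imp fun h => e.injective.image_strictMono h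
    · rw [List.mem_map]
      constructor
      · rintro ⟨K, hK, rfl⟩
        obtain ⟨h1, h2, h3⟩ := (hl.2 K).1 hK
        exact ⟨(he K).2 h1, Set.mem_image_of_mem e h2, by
          rwa [e.injective.mem_set_image]⟩
      · rintro ⟨h1, h2, h3⟩
        have hH : e '' (e ⁻¹' H) = H := Set.image_preimage_eq H e.surjective
        refine ⟨e ⁻¹' H, (hl.2 _).2 ⟨(he _).1 (by rwa [hH]), h2, h3⟩, hH⟩
  rw [cocycle_eq hl', cocycle_eq hl, List.map_map, map_list_prod, List.map_map]
  congr 1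
  exact List.map_congr_left fun H hH => hφ H ((hl.2 H).1 hH).1

end WallSpace

namespace HyperbolicSurface

open IsomPlus

variable {G : Type*} [Group G]

namespace ClosedGeodesic

variable {X : HyperbolicSurface G} (x : X.ClosedGeodesic)

/-! ### The lifts of a simple closed geodesic -/

theorem hol_deck : X.hol x.deck = x.frame * translation x.len * x.frame⁻¹ := by
  rw [eq_mul_inv_iff_mul_eq]
  refine eq_of_line_eq fun t => ?_
  rw [← smul_line, x.hol_deck_smul, mul_translation_line, add_comm]

theorem lift_mul (γ δ : G) : x.lift (γ * δ) = X.hol γ * x.lift δ := by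
  rw [lift, lift, map_mul, mul_assoc]

theorem lift_mul_deck_zpow (γ : G) (n : ℤ) :
    x.lift (γ * x.deck ^ n) = x.lift γ * translation (n * x.len) := by
  rw [lift, lift, map_mul, map_zpow, hol_deck, conj_zpow, translation_zpow]
  group

/-- The frames of the lifts of the closed geodesic, with both orientations. -/
def frames : Set IsomPlus := {g | ∃ γ, g = x.lift γ ∨ g = x.lift γ * halfTurn}

theorem lift_mem_frames (γ : G) : x.lift γ ∈ x.frames := ⟨γ, Or.inl rfl⟩

variable {x}

theorem mul_halfTurn_mem_frames {g : IsomPlus} (h : g ∈ x.frames) : g * halfTurn ∈ x.frames := by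
  obtain ⟨γ, rfl | rfl⟩ := h
  · exact ⟨γ, Or.inr rfl⟩
  · exact ⟨γ, Or.inl (by rw [mul_assoc, halfTurn_mul_halfTurn, mul_one])⟩

theorem hol_mul_mem_frames {g : IsomPlus} (γ : G) (h : g ∈ x.frames) : X.hol γ * g ∈ x.frames := by
  obtain ⟨δ, rfl | rfl⟩ := h
  · exact ⟨γ * δ, Or.inl (x.lift_mul γ δ).symm⟩
  · exact ⟨γ * δ, Or.inr (by rw [lift_mul, mul_assoc])⟩

theorem mem_preimage {z : ℍ} : z ∈ x.preimage ↔ ∃ g ∈ x.frames, z ∈ Set.range g.line := by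
  constructor
  · rintro ⟨γ, t, rfl⟩
    exact ⟨_, x.lift_mem_frames γ, t, rfl⟩
  · rintro ⟨g, ⟨γ, rfl | rfl⟩, h⟩
    · obtain ⟨t, rfl⟩ := h
      exact ⟨γ, t, rfl⟩
    · rw [range_line_mul_halfTurn] at h
      obtain ⟨t, rfl⟩ := h
      exact ⟨γ, t, rfl⟩

theorem hol_smul_mem_preimage (γ : G) {z : ℍ} : X.hol γ • z ∈ x.preimage ↔ z ∈ x.preimage := by
  have key : ∀ (γ : G) {z : ℍ}, z ∈ x.preimage → X.hol γ • z ∈ x.preimage := by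
    rintro γ z ⟨δ, t, rfl⟩
    exact ⟨γ * δ, t, by rw [lift_mul, smul_line]⟩
  refine ⟨fun h => ?_, key γ⟩
  have := key γ⁻¹ h
  rwa [map_inv, inv_smul_smul] at this

/-- Every point of a lift is in a translate of a fundamental segment of the closed geodesic. -/
theorem exists_mem_Icc (x : X.ClosedGeodesic) (γ : G) (t : ℝ) : ∃ (n : ℤ) (u : ℝ),
    u ∈ Set.Icc 0 x.len ∧
    (x.lift γ).line t = (x.lift (γ * x.deck ^ n)).line u := by
  refine ⟨⌊t / x.len⌋, t - ⌊t / x.len⌋ * x.len, ⟨?_, ?_⟩, ?_⟩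
  · have := Int.floor_le (t / x.len)
    rw [le_div_iff₀ x.len_pos] at this
    linarith
  · have := (Int.lt_floor_add_one (t / x.len)).le
    rw [div_le_iff₀ x.len_pos] at this
    linarith
  · rw [lift_mul_deck_zpow, mul_translation_line]
    congr 1; ring

theorem finite_meet (x : X.ClosedGeodesic) {K : Set ℍ} (hK : IsCompact K) :
    {γ : G | ∃ t ∈ Set.Icc 0 x.len, (x.lift γ).line t ∈ K}.Finite := by
  have hS : IsCompact (x.frame.line '' Set.Icc 0 x.len) :=
    isCompact_Icc.image (continuous_line _)
  refine (X.properlyDiscontinuous _ (hK.union hS)).subset ?_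
  rintro γ ⟨t, ht, h⟩
  exact ⟨x.frame.line t, Or.inr ⟨t, ht, rfl⟩, Or.inl (by rwa [smul_line])⟩

/-- As the deck group acts freely, the deck transformation that exhibits a coincidence of two
points of a simple closed geodesic is a power of the one which translates along it. -/
theorem lift_sameLine_of_meet (hx : x.IsSimple) {γ δ : G} {t u : ℝ}
    (h : (x.lift γ).line t = (x.lift δ).line u) : ∃ r, x.lift γ = x.lift δ * translation r := by
  have h1 : X.hol (δ⁻¹ * γ) • x.frame.line t = x.frame.line u := by
    rw [map_mul, map_inv, mul_smul, inv_smul_eq_iff, smul_line, smul_line]; exact h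
  obtain ⟨n, hn⟩ := hx _ _ _ h1
  have h2 : X.hol ((x.deck ^ n)⁻¹ * (δ⁻¹ * γ)) • x.frame.line t = x.frame.line t := by
    rw [map_mul, mul_smul, h1, map_inv, inv_smul_eq_iff, smul_line, map_zpow, hol_deck, conj_zpow,
      translation_zpow, inv_mul_cancel_right, mul_translation_line, hn, add_comm]
  have h3 := X.free _ _ h2
  refine ⟨n * x.len, ?_⟩
  rw [← lift_mul_deck_zpow, inv_mul_eq_one.1 h3, mul_inv_cancel_left]

/-- Two lifts of a simple closed geodesic coincide or are disjoint. -/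
theorem sameLine_of_meet (hx : x.IsSimple) {g k : IsomPlus} (hg : g ∈ x.frames) (hk : k ∈ x.frames)
    {z : ℍ} (hzg : z ∈ Set.range g.line) (hzk : z ∈ Set.range k.line) : SameLine g k := by
  obtain ⟨γ, hγ⟩ := hg
  obtain ⟨δ, hδ⟩ := hk
  have hzg' : z ∈ Set.range (x.lift γ).line := by
    rcases hγ with rfl | rfl
    · exact hzg
    · rwa [range_line_mul_halfTurn] at hzg
  have hzk' : z ∈ Set.range (x.lift δ).line := by
    rcases hδ with rfl | rfl
    · exact hzk
    · rwa [range_line_mul_halfTurn] at hzk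
  obtain ⟨t, rfl⟩ := hzg'
  obtain ⟨u, hu⟩ := hzk'
  obtain ⟨r, hr⟩ := lift_sameLine_of_meet hx hu
  rcases hγ with rfl | rfl <;> rcases hδ with rfl | rfl
  · exact ⟨r, Or.inl hr⟩
  · refine ⟨-r, Or.inr ?_⟩
    rw [hr, mul_assoc, mul_assoc, translation_mul_halfTurn]
  · refine ⟨r, Or.inr ?_⟩
    rw [hr, mul_assoc _ halfTurn halfTurn, halfTurn_mul_halfTurn, mul_one]
  · refine ⟨-r, Or.inl ?_⟩
    rw [hr, mul_assoc, mul_assoc, translation_mul_halfTurn]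

theorem exists_pos_le_of_finite {ι : Type*} {F : Set ι} (hF : F.Finite) (δ : ι → ℝ)
    (hδ : ∀ i, 0 < δ i) : ∃ ε, 0 < ε ∧ ∀ i ∈ F, ε ≤ δ i := by
  rcases F.eq_empty_or_nonempty with rfl | hne
  · exact ⟨1, one_pos, by simp⟩
  · obtain ⟨i, hi, h⟩ := Set.exists_min_image F δ hF hne
    exact ⟨δ i, hδ i, h⟩

/-- By compactness of the closed geodesic, only finitely many lifts come close to a fundamental
segment, and each of them is disjoint from it or is the same lift. -/
theorem exists_dist_lift (hx : x.IsSimple) : ∃ ε, 0 < ε ∧ ∀ γ δ : G,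
    (∃ r, x.lift γ = x.lift δ * translation r) ∨
      ∀ t u, ε ≤ dist ((x.lift δ).line t) ((x.lift γ).line u) := by
  set K := x.frame.line '' Set.Icc 0 x.len with hKdef
  have hK : IsCompact K := isCompact_Icc.image (continuous_line _)
  have hF := x.finite_meet (hK.cthickening (r := 1))
  have hloc : ∀ γ : G, ∃ ε, 0 < ε ∧ ((∃ r, x.lift γ = x.frame * translation r) ∨
      ∀ t ∈ Set.Icc 0 x.len, ∀ u ∈ Set.Icc 0 x.len,
        ε ≤ dist (x.frame.line t) ((x.lift γ).line u)) := by
    intro γ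
    by_cases h : ∃ r, x.lift γ = x.frame * translation r
    · exact ⟨1, one_pos, Or.inl h⟩
    · have hK' : IsCompact ((x.lift γ).line '' Set.Icc 0 x.len) :=
        isCompact_Icc.image (continuous_line _)
      have hdisj : Disjoint K ((x.lift γ).line '' Set.Icc 0 x.len) := by
        rw [Set.disjoint_left]
        rintro _ ⟨t, _, rfl⟩ ⟨u, _, hu⟩
        refine h ?_
        have h1 : x.lift 1 = x.frame := by rw [lift, map_one, one_mul]
        have := lift_sameLine_of_meet hx (γ := γ) (δ := 1) (t := u) (u := t) (by rw [hu, h1])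
        rwa [h1] at this
      obtain ⟨ε, hε, hd⟩ := Metric.exists_pos_forall_lt_edist hK hK'.isClosed hdisj
      refine ⟨ε, hε, Or.inr fun t ht u hu => ?_⟩
      have := hd _ ⟨t, ht, rfl⟩ _ ⟨u, hu, rfl⟩
      rw [edist_nndist] at this
      have h2 : ε < nndist (x.frame.line t) ((x.lift γ).line u) := by exact_mod_cast this
      exact le_of_lt h2
  choose ε hε hloc using hloc
  obtain ⟨ε₀, hε₀, hmin⟩ := exists_pos_le_of_finite hF ε hε
  refine ⟨min ε₀ 1, lt_min hε₀ one_pos, fun γ δ => ?_⟩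
  by_contra! H
  obtain ⟨hne, t, u, htu⟩ := H
  obtain ⟨n, t', ht', ht⟩ := x.exists_mem_Icc δ t
  obtain ⟨m, u', hu', hu⟩ := x.exists_mem_Icc γ u
  set η := (δ * x.deck ^ n)⁻¹ * (γ * x.deck ^ m) with hη
  have hdist : dist (x.frame.line t') ((x.lift η).line u') < min ε₀ 1 := by
    rw [ht, hu] at htu
    rw [← IsomPlus.dist_smul (X.hol (δ * x.deck ^ n)), smul_line, smul_line, ← lift_mul, hη,
      mul_inv_cancel_left]
    exact htu
  have hηF : η ∈ {γ : G | ∃ t ∈ Set.Icc 0 x.len, (x.lift γ).line t ∈ Metric.cthickening 1 K} := by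
    refine ⟨u', hu', Metric.mem_cthickening_of_dist_le _ (x.frame.line t') _ _ ⟨t', ht', rfl⟩ ?_⟩
    rw [dist_comm]
    exact hdist.le.trans (min_le_right _ _)
  rcases hloc η with ⟨r, hr⟩ | h
  · refine hne (n * x.len + (r - m * x.len)) ?_
    have h1 : x.lift (γ * x.deck ^ m) = x.lift (δ * x.deck ^ n) * translation r := by
      have h2 : γ * x.deck ^ m = (δ * x.deck ^ n) * η := by rw [hη, mul_inv_cancel_left]
      rw [h2, lift_mul, hr, ← mul_assoc]; rfl
    rw [lift_mul_deck_zpow, lift_mul_deck_zpow] at h1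
    rw [translation_add, sub_eq_add_neg, translation_add, ← mul_assoc, ← mul_assoc, ← h1, mul_assoc,
      ← translation_add]
    simp
  · have := h t' ht' u' hu'
    have := hmin η hηF
    have := min_le_left ε₀ 1
    linarith

/-- Distinct lifts of a simple closed geodesic have distance bounded from below. -/
theorem exists_separation (hx : x.IsSimple) : ∃ ε, 0 < ε ∧ ∀ g ∈ x.frames, ∀ k ∈ x.frames,
    SameLine g k ∨ ∀ t u, ε ≤ dist (g.line t) (k.line u) := by
  obtain ⟨ε, hε, H⟩ := exists_dist_lift hx
  refine ⟨ε, hε, fun g hg k hk => ?_⟩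
  by_cases hm : ∃ z, z ∈ Set.range g.line ∧ z ∈ Set.range k.line
  · obtain ⟨z, h1, h2⟩ := hm
    exact Or.inl (sameLine_of_meet hx hg hk h1 h2)
  · right
    push Not at hm
    have key : ∀ f ∈ x.frames, ∃ (γ : G), Set.range f.line = Set.range (x.lift γ).line := by
      rintro f ⟨γ, rfl | rfl⟩
      · exact ⟨γ, rfl⟩
      · exact ⟨γ, range_line_mul_halfTurn _⟩
    obtain ⟨γ, hγ⟩ := key g hg
    obtain ⟨δ, hδ⟩ := key k hk
    intro t u
    obtain ⟨t', ht'⟩ : g.line t ∈ Set.range (x.lift γ).line := hγ ▸ ⟨t, rfl⟩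
    obtain ⟨u', hu'⟩ : k.line u ∈ Set.range (x.lift δ).line := hδ ▸ ⟨u, rfl⟩
    rcases H δ γ with ⟨r, hr⟩ | h
    · refine absurd ?_ (hm (g.line t) ⟨t, rfl⟩)
      rw [hδ, hr, range_line_mul_translation, ← hγ]
      exact ⟨t, rfl⟩
    · rw [← ht', ← hu']; exact h _ _

/-! ### Points off the lifts -/

/-- A geodesic that is not a lift meets each lift at most once, and on a compact segment it meets
only finitely many of them. -/
theorem finite_mem_preimage {k : IsomPlus} (hk : ∀ f ∈ x.frames, ¬ SameLine f k) (t u : ℝ) :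
    {v | v ∈ Set.Icc t u ∧ k.line v ∈ x.preimage}.Finite := by
  have hF := x.finite_meet ((isCompact_Icc (a := t) (b := u)).image k.continuous_line)
  refine (hF.biUnion (t := fun γ => {v | k.line v ∈ Set.range (x.lift γ).line}) fun γ _ =>
      ?_).subset ?_
  · refine Set.Subsingleton.finite fun v hv w hw => ?_
    have h1 := sameLine_or_crossing hv
    rcases h1 with h | h | h
    · exact absurd h (hk _ (x.lift_mem_frames γ))
    · by_contra hne
      rcases lt_or_gt_of_ne hne with hvw | hvw
      · exact notMem_range_of_mem_rightSide ((h w).2 hvw) hw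
      · exact notMem_range_of_mem_leftSide ((h w).1 hvw) hw
    · by_contra hne
      rcases lt_or_gt_of_ne hne with hvw | hvw
      · exact notMem_range_of_mem_leftSide ((h w).2 hvw) hw
      · exact notMem_range_of_mem_rightSide ((h w).1 hvw) hw
  · rintro v ⟨hv, γ, r, hr⟩
    obtain ⟨n, r', hr', h⟩ := x.exists_mem_Icc γ r
    rw [h] at hr
    exact Set.mem_biUnion (x := γ * x.deck ^ n) ⟨r', hr', v, hv, hr⟩ ⟨r', hr.symm⟩

theorem exists_notMem_preimage {k : IsomPlus} (hk : ∀ f ∈ x.frames, ¬ SameLine f k) {t u : ℝ}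
    (htu : t < u) : ∃ v, t < v ∧ v < u ∧ k.line v ∉ x.preimage := by
  by_contra! H
  refine (Set.Ioo_infinite htu)
      ((finite_mem_preimage hk t u).subset fun v hv => ⟨⟨hv.1.le, hv.2.le⟩, ?_⟩)
  exact H v hv.1 hv.2

theorem not_sameLine_of_notMem {k : IsomPlus} {t : ℝ} (h : k.line t ∉ x.preimage) :
    ∀ f ∈ x.frames, ¬ SameLine f k := by
  intro f hf hs
  exact h (mem_preimage.2 ⟨f, hf, hs.range_eq ▸ ⟨t, rfl⟩⟩)

theorem not_sameLine_of_crossing (hx : x.IsSimple) {g k : IsomPlus} (hg : g ∈ x.frames) {t u : ℝ}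
    (ht : k.line t ∈ Set.range g.line) (hu : k.line u ∉ Set.range g.line) :
    ∀ f ∈ x.frames, ¬ SameLine f k := by
  intro f hf hs
  have h1 : k.line t ∈ Set.range f.line := hs.range_eq ▸ ⟨t, rfl⟩
  have h2 := (sameLine_of_meet hx hg hf ht h1).range_eq
  exact hu (h2 ▸ hs.range_eq ▸ ⟨u, rfl⟩)

/-- Any geodesic is crossed by another one, here by the one with endpoints `-1` and `1` in the
coordinates of `g`. -/
theorem exists_transversal (g : IsomPlus) : ∃ (k : IsomPlus) (t : ℝ), k.line t ∈ Set.range g.line ∧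
    (∀ u, u < t → k.line u ∈ g.leftSide) ∧ ∀ u, t < u → k.line u ∈ g.rightSide := by
  have h : ∀ u, u < 0 → (g * moebius (mat 1 (-1 / 2) 1 (1 / 2) (by norm_num)) *
      translation (-Real.log 2)).line u ∈ g.leftSide := fun u hu => by
    rw [mul_translation_line, line_mem_leftSide_moebius, Real.exp_add, Real.exp_neg,
      Real.exp_log two_pos]
    simp
    have := Real.exp_lt_one_iff.2 hu
    have := Real.exp_pos u
    nlinarith
  have h0 : (g * moebius (mat 1 (-1 / 2) 1 (1 / 2) (by norm_num)) *
      translation (-Real.log 2)).line 0 ∈ Set.range g.line := by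
    rw [mul_translation_line, line_mem_range_moebius, Real.exp_add, Real.exp_neg,
      Real.exp_log two_pos]
    norm_num
  have h' : ∀ u, 0 < u → (g * moebius (mat 1 (-1 / 2) 1 (1 / 2) (by norm_num)) *
      translation (-Real.log 2)).line u ∈ g.rightSide := fun u hu => by
    rw [mul_translation_line, line_mem_rightSide_moebius, Real.exp_add, Real.exp_neg,
      Real.exp_log two_pos]
    simp
    have := Real.one_lt_exp_iff.2 hu
    nlinarith
  exact ⟨_, 0, h0, h, h'⟩

theorem exists_off_leftSide (hx : x.IsSimple) {g : IsomPlus} (hg : g ∈ x.frames) :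
    ∃ z ∉ x.preimage, z ∈ g.leftSide := by
  obtain ⟨k, t, h, hl, -⟩ := exists_transversal g
  obtain ⟨v, hv1, hv2, hv⟩ := exists_notMem_preimage (not_sameLine_of_crossing hx hg h
    (notMem_range_of_mem_leftSide (hl (t - 1) (by linarith)))) (show t - 1 < t by linarith)
  exact ⟨_, hv, hl v hv2⟩

theorem exists_off_rightSide (hx : x.IsSimple) {g : IsomPlus} (hg : g ∈ x.frames) :
    ∃ z ∉ x.preimage, z ∈ g.rightSide := by
  have := exists_off_leftSide hx (mul_halfTurn_mem_frames hg)
  rwa [leftSide_mul_halfTurn] at this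

theorem line_mem_leftSide_of_before {g k : IsomPlus} (h : Before g k) (t : ℝ) :
    g.line t ∈ k.leftSide :=
  h.mem_leftSide fun h' => notMem_range_of_mem_rightSide h' ⟨t, rfl⟩

theorem line_mem_rightSide_of_before {g k : IsomPlus} (h : Before g k) (t : ℝ) :
    k.line t ∈ g.rightSide :=
  h.mem_rightSide fun h' => notMem_range_of_mem_leftSide h' ⟨t, rfl⟩

theorem exists_off_between (hx : x.IsSimple) {g k : IsomPlus} (hg : g ∈ x.frames)
    (h : Before g k) : ∃ z ∉ x.preimage, z ∈ g.rightSide ∧ z ∈ k.leftSide := by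
  obtain ⟨l, hl0, hl1⟩ := exists_line_through (g.line 0) (k.line 0)
  have h0 : l.line 0 ∈ k.leftSide := hl0 ▸ line_mem_leftSide_of_before h 0
  have h0' : l.line 0 ∈ Set.range g.line := hl0 ▸ ⟨0, rfl⟩
  have h1 : l.line (dist (g.line 0) (k.line 0)) ∈ g.rightSide :=
    by
    rw [hl1]; exact line_mem_rightSide_of_before h 0
  have h1' : l.line (dist (g.line 0) (k.line 0)) ∈ Set.range k.line := by
    rw [hl1]; exact ⟨0, rfl⟩
  have hd : 0 < dist (g.line 0) (k.line 0) := by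
    rw [dist_pos]; intro he
    have := line_mem_leftSide_of_before h 0
    rw [he] at this
    exact notMem_range_of_mem_leftSide this ⟨0, rfl⟩
  obtain ⟨v, hv1, hv2, hv⟩ := exists_notMem_preimage
    (not_sameLine_of_crossing hx hg h0' (notMem_range_of_mem_rightSide h1)) hd
  refine ⟨_, hv, ?_, ?_⟩
  · rcases sameLine_or_crossing h0' with hs | hs | hs
    · exact absurd (hs.range_eq ▸ ⟨_, rfl⟩) (notMem_range_of_mem_rightSide h1)
    · exact (hs v).2 hv1
    · exact absurd ((hs _).2 hd) (notMem_leftSide_of_mem_rightSide h1)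
  · rcases sameLine_or_crossing h1' with hs | hs | hs
    · exact absurd (hs.range_eq ▸ ⟨_, rfl⟩) (notMem_range_of_mem_leftSide h0)
    · exact (hs v).1 hv2
    · exact absurd h0 (notMem_leftSide_of_mem_rightSide ((hs 0).1 hd))

/-! ### The wall space of the lifts -/

/-- Up to orientation, two lifts of a simple closed geodesic coincide or are nested. -/
theorem sameLine_or_before (hx : x.IsSimple) {g k : IsomPlus} (hg : g ∈ x.frames)
    (hk : k ∈ x.frames) : SameLine g k ∨ Before g k ∨ Before g (k * halfTurn) ∨
      Before (g * halfTurn) k ∨ Before (g * halfTurn) (k * halfTurn) := by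
  obtain ⟨ε, hε, H⟩ := exists_separation hx
  rcases H g hg k hk with h | h
  · exact Or.inl h
  right
  have h' : ∀ t u, ε ≤ dist ((g * halfTurn).line t) (k.line u) := fun t u => by
    rw [mul_halfTurn_line]; exact h _ _
  have hk' : ∀ t, k.line t ∉ Set.range g.line := by
    rintro t ⟨u, hu⟩
    have := h u t
    rw [hu, dist_self] at this
    linarith
  have hg' : ∀ t, g.line t ∉ Set.range k.line := by
    rintro t ⟨u, hu⟩
    exact hk' u ⟨t, hu.symm⟩
  rcases line_side_of_disjoint hk' with h1 | h1 <;> rcases line_side_of_disjoint hg' with h2 | h2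
  · right; right; left
    refine before_of_dist hε h' ⟨0, by rw [rightSide_mul_halfTurn]; exact h1 0⟩
      ⟨0, by rw [mul_halfTurn_line]; exact h2 _⟩
  · right; right; right
    refine before_of_dist hε (fun t u => by rw [mul_halfTurn_line k]; exact h' _ _)
      ⟨0, by rw [rightSide_mul_halfTurn, mul_halfTurn_line]; exact h1 _⟩
      ⟨0, by rw [leftSide_mul_halfTurn, mul_halfTurn_line]; exact h2 _⟩
  · left
    exact before_of_dist hε h ⟨0, h1 0⟩ ⟨0, h2 0⟩
  · right; left
    refine before_of_dist hε (fun t u => by rw [mul_halfTurn_line k]; exact h _ _)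
      ⟨0, by rw [mul_halfTurn_line]; exact h1 _⟩
      ⟨0, by rw [leftSide_mul_halfTurn]; exact h2 _⟩

/-- Lifts that separate two points are linearly ordered. -/
theorem trichotomy_of_separates (hx : x.IsSimple) {g k : IsomPlus} (hg : g ∈ x.frames)
    (hk : k ∈ x.frames) {z w : ℍ} (hzg : z ∈ g.leftSide) (hwg : w ∈ g.rightSide)
    (hzk : z ∈ k.leftSide) (hwk : w ∈ k.rightSide) :
    (∃ r, k = g * translation r) ∨ Before g k ∨ Before k g := by
  rcases sameLine_or_before hx hg hk with h | h | h | h | h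
  · obtain ⟨r, h | h⟩ := h
    · exact Or.inl ⟨r, h⟩
    · rw [h, leftSide_mul_translation, leftSide_mul_halfTurn] at hzk
      exact absurd hzg (notMem_leftSide_of_mem_rightSide hzk)
  · exact Or.inr (Or.inl h)
  · have := h.mem_leftSide (fun h' => notMem_leftSide_of_mem_rightSide h' hzg)
    rw [leftSide_mul_halfTurn] at this
    exact absurd hzk (notMem_leftSide_of_mem_rightSide this)
  · have := h.mem_rightSide (notMem_leftSide_of_mem_rightSide hwk)
    rw [rightSide_mul_halfTurn] at this
    exact absurd this (notMem_leftSide_of_mem_rightSide hwg)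
  · right; right
    obtain ⟨ε, hε, H⟩ := exists_separation hx
    have hl := line_mem_rightSide_of_before h 0
    have hr := line_mem_leftSide_of_before h 0
    rw [rightSide_mul_halfTurn, mul_halfTurn_line] at hl
    rw [leftSide_mul_halfTurn, mul_halfTurn_line] at hr
    rcases H k hk g hg with h' | h'
    · exact absurd (h'.range_eq ▸ ⟨_, rfl⟩) (notMem_range_of_mem_rightSide hr)
    · exact before_of_dist hε h' ⟨_, hr⟩ ⟨_, hl⟩

variable (x)

/-- The complement of the lifts; its components are the pieces into which the geodesic cuts. -/
abbrev Off : Type := {z : ℍ // z ∉ x.preimage}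

/-- The points off the lifts that lie to the left of the frame. -/
def half (g : IsomPlus) : Set x.Off := {z | (z : ℍ) ∈ g.leftSide}

variable {x}

theorem notMem_half {g : IsomPlus} (hg : g ∈ x.frames) {z : x.Off} :
    z ∉ x.half g ↔ (z : ℍ) ∈ g.rightSide := by
  constructor
  · intro h
    refine ((mem_line_or_side g z).resolve_left fun h' => ?_).resolve_left h
    exact z.2 (mem_preimage.2 ⟨g, hg, h'⟩)
  · exact fun h => notMem_leftSide_of_mem_rightSide h

theorem half_mul_halfTurn {g : IsomPlus} (hg : g ∈ x.frames) :
    x.half (g * halfTurn) = (x.half g)ᶜ := by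
  ext z
  rw [Set.mem_compl_iff, notMem_half hg, ← leftSide_mul_halfTurn]; rfl

theorem half_mul_translation (g : IsomPlus) (r : ℝ) :
    x.half (g * translation r) = x.half g := by
  ext z
  show (z : ℍ) ∈ (g * translation r).leftSide ↔ (z : ℍ) ∈ g.leftSide
  rw [leftSide_mul_translation]

theorem half_subset_of_before {g k : IsomPlus} (h : Before g k) : x.half g ⊆ x.half k :=
  fun _ hz => h.mem_leftSide fun h' => notMem_leftSide_of_mem_rightSide h' hz

/-- The half-planes bounded by the lifts of a simple closed geodesic. -/
def walls (hx : x.IsSimple) : WallSpace x.Off where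
  halfSpaces := x.half '' x.frames
  compl_mem := by
    rintro _ ⟨g, hg, rfl⟩
    exact ⟨g * halfTurn, mul_halfTurn_mem_frames hg, half_mul_halfTurn hg⟩
  nested := by
    rintro _ ⟨g, hg, rfl⟩ _ ⟨k, hk, rfl⟩
    rcases sameLine_or_before hx hg hk with h | h | h | h | h
    · obtain ⟨r, rfl | rfl⟩ := h
      · exact Or.inl (half_mul_translation g r).ge
      · right; right; left
        rw [half_mul_translation, half_mul_halfTurn hg, Set.inter_compl_self]
    · exact Or.inl (half_subset_of_before h)
    · have := half_subset_of_before (x := x) h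
      rw [half_mul_halfTurn hk, Set.subset_compl_iff_disjoint_right] at this
      exact Or.inr (Or.inr (Or.inl this.inter_eq))
    · have := half_subset_of_before (x := x) h
      rw [half_mul_halfTurn hg, Set.compl_subset_iff_union] at this
      exact Or.inr (Or.inr (Or.inr this))
    · have := half_subset_of_before (x := x) h
      rw [half_mul_halfTurn hg, half_mul_halfTurn hk, Set.compl_subset_compl] at this
      exact Or.inr (Or.inl this)
  finite_sep := by
    intro z w
    obtain ⟨k, hk0, hk1⟩ := exists_line_through z w
    have hF := x.finite_meet ((isCompact_Icc (a := (0 : ℝ)) (b := dist (z : ℍ) w)).image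
      k.continuous_line)
    refine ((hF.image fun γ => x.half (x.lift γ)).union
      (hF.image fun γ => x.half (x.lift γ * halfTurn))).subset ?_
    rintro _ ⟨⟨g, hg, rfl⟩, hz, hw⟩
    rw [notMem_half hg] at hw
    have hd : 0 < dist (z : ℍ) w := by
      rw [dist_pos]; intro he
      rw [← he] at hw
      exact notMem_leftSide_of_mem_rightSide hw hz
    obtain ⟨v, hv1, hv2, hv, -⟩ := exists_crossing (g := g) (k := k) hd (by rw [hk0]; exact hz)
      (by rw [hk1]; exact hw)
    obtain ⟨γ, hγ⟩ := hg
    have hv' : k.line v ∈ Set.range (x.lift γ).line := by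
      rcases hγ with rfl | rfl
      · exact hv
      · rwa [range_line_mul_halfTurn] at hv
    obtain ⟨t, ht⟩ := hv'
    obtain ⟨n, u, hu, h⟩ := x.exists_mem_Icc γ t
    have hmem : γ * x.deck ^ n ∈ {γ : G | ∃ t ∈ Set.Icc 0 x.len,
        (x.lift γ).line t ∈ k.line '' Set.Icc 0 (dist (z : ℍ) w)} :=
      ⟨u, hu, v, ⟨hv1.le, hv2.le⟩, by rw [← h, ht]⟩
    rcases hγ with rfl | rfl
    · left
      exact ⟨_, hmem, by simp only [lift_mul_deck_zpow, half_mul_translation]⟩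
    · right
      refine ⟨_, hmem, ?_⟩
      simp only [lift_mul_deck_zpow, mul_assoc, translation_mul_halfTurn]
      rw [← mul_assoc, half_mul_translation]

/-- A half-plane determines the lift that bounds it, since there are points off the lifts between
any two lifts. -/
theorem exists_translation_of_half_eq (hx : x.IsSimple) {g k : IsomPlus} (hg : g ∈ x.frames)
    (hk : k ∈ x.frames) (h : x.half g = x.half k) : ∃ r, k = g * translation r := by
  obtain ⟨z, hz, hzg⟩ := exists_off_leftSide hx hg
  obtain ⟨w, hw, hwg⟩ := exists_off_rightSide hx hg
  have hzk : z ∈ k.leftSide := show (⟨z, hz⟩ : x.Off) ∈ x.half k from h ▸ hzg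
  have hwk : w ∈ k.rightSide := (notMem_half hk (z := ⟨w, hw⟩)).1 (h ▸ (notMem_half hg).2 hwg)
  rcases trichotomy_of_separates hx hg hk hzg hwg hzk hwk with h' | h' | h'
  · exact h'
  · obtain ⟨v, hv, hv1, hv2⟩ := exists_off_between hx hg h'
    have : (⟨v, hv⟩ : x.Off) ∈ x.half g := h ▸ hv2
    exact absurd this (notMem_leftSide_of_mem_rightSide hv1)
  · obtain ⟨v, hv, hv1, hv2⟩ := exists_off_between hx hk h'
    have : (⟨v, hv⟩ : x.Off) ∈ x.half k := h ▸ hv2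
    exact absurd this (notMem_leftSide_of_mem_rightSide hv1)

end ClosedGeodesic
end HyperbolicSurface

namespace IsomPlus

/-! ### Products of translations along a chain of geodesics -/

/-- The translation by the distance `s` along the geodesic `g.line`. -/
def shear (s : ℝ) (g : IsomPlus) : IsomPlus := g * translation s * g⁻¹

theorem shear_mul_translation (s r : ℝ) (g : IsomPlus) : shear s (g * translation r) = shear s g :=
    by
  have := translation_comm r s
  rw [shear, shear, mul_inv_rev, mul_assoc g, this]
  group

theorem shear_mul_halfTurn (s : ℝ) (g : IsomPlus) : shear s (g * halfTurn) = shear (-s) g := by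
  rw [shear, shear, mul_inv_rev, mul_assoc g, ← neg_neg s, ← translation_mul_halfTurn, neg_neg]
  group

theorem shear_neg (s : ℝ) (g : IsomPlus) : shear (-s) g = (shear s g)⁻¹ := by
  rw [shear, shear, translation_neg]; group

theorem mul_shear (s : ℝ) (g k : IsomPlus) : shear s (k * g) = k * shear s g * k⁻¹ := by
  rw [shear, shear]; group

theorem shear_smul_line (s : ℝ) (g : IsomPlus) (t : ℝ) : shear s g • g.line t = g.line (s + t) := by
  rw [shear, smul_line, inv_mul_cancel_right, mul_translation_line]

theorem shear_smul_mem_rightSide (s : ℝ) (g : IsomPlus) (z : ℍ) :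
    shear s g • z ∈ g.rightSide ↔ z ∈ g.rightSide := by
  rw [← smul_mem_rightSide (shear s g) g z, shear, inv_mul_cancel_right, rightSide_mul_translation]

/-- Each translation preserves the half-plane beyond its own axis, and these half-planes are
nested. -/
theorem shears_smul_mem_rightSide (s : ℝ) {l : List IsomPlus} {w : ℍ} (hl : l.Pairwise Before)
    (hw : ∀ k ∈ l, w ∈ k.rightSide) {g : IsomPlus} (hg : ∀ k ∈ l, Before g k)
    (hwg : w ∈ g.rightSide) : (l.map (shear s)).prod • w ∈ g.rightSide := by
  induction l generalizing g with
  | nil => simpa using hwg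
  | cons k l ih =>
    rw [List.pairwise_cons] at hl
    rw [List.map_cons, List.prod_cons, mul_smul]
    have h1 := ih hl.2 (fun f hf => hw f (List.mem_cons_of_mem k hf)) hl.1
      (hw k List.mem_cons_self)
    refine (hg k List.mem_cons_self).mem_rightSide (notMem_leftSide_of_mem_rightSide ?_)
    rwa [shear_smul_mem_rightSide]

/-- A point on `g.line` through which the distance from `z` to `w` is additive. -/
theorem exists_dist_add {g : IsomPlus} {z w : ℍ} (hz : z ∉ g.rightSide) (hw : w ∈ g.rightSide) :
    ∃ t, dist z (g.line t) + dist (g.line t) w = dist z w := by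
  rcases mem_line_or_side g z with ⟨t, ht⟩ | h | h
  · exact ⟨t, by rw [ht]; simp⟩
  · obtain ⟨k, hk0, hk1⟩ := exists_line_through z w
    have hd : 0 < dist z w := by
      rw [dist_pos]; rintro rfl; exact hz hw
    obtain ⟨v, hv1, hv2, ⟨t, ht⟩, -⟩ := exists_crossing hd (hk0.symm ▸ h) (by rwa [hk1])
    refine ⟨t, ?_⟩
    have h1 : dist z (g.line t) = v := by
      rw [ht, ← hk0, dist_line, abs_of_neg] <;> linarith
    have h2 : dist (g.line t) w = dist z w - v := by
      rw [ht]
      nth_rw 1 [← hk1]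
      rw [dist_line, abs_of_neg] <;> linarith
    rw [h1, h2]; ring
  · exact absurd h hz

/-- The ordered product of the translations along a chain of nested, uniformly separated geodesics
between `z` and `w` does not bring `w` much closer to `z`: the geodesic from `z` to the image of `w`
crosses the images of all the geodesics, so their number is bounded in terms of its length; and
translating back the pieces into which they divide it gives a path from `z` to `w`, up to jumps of
length `|s|`. -/
theorem dist_shears {ε s : ℝ} {l : List IsomPlus} {z w : ℍ} (hl : l.Pairwise Before)
    (hε : l.Pairwise fun g k => ∀ t u, ε ≤ dist (g.line t) (k.line u))
    (hz : ∀ k ∈ l, z ∉ k.rightSide) (hw : ∀ k ∈ l, w ∈ k.rightSide) {e : ℝ} (he : 0 ≤ e)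
    (hze : ∀ k ∈ l, ∀ u, ε - e ≤ dist z (k.line u)) :
    dist z w ≤ dist z ((l.map (shear s)).prod • w) + l.length * |s| ∧
      l.length * ε ≤ dist z ((l.map (shear s)).prod • w) + e := by
  -- `e` is `ε` for the first point and `0` for the later ones, which lie on one of the geodesics
  induction l generalizing z e with
  | nil => simpa using add_nonneg dist_nonneg he
  | cons g l ih =>
    rw [List.pairwise_cons] at hl hε
    have h1 := shears_smul_mem_rightSide s hl.2 (fun f hf => hw f (List.mem_cons_of_mem g hf)) hl.1
      (hw g List.mem_cons_self)
    rw [List.map_cons, List.prod_cons, mul_smul, List.length_cons]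
    set w' := (l.map (shear s)).prod • w with hw'
    obtain ⟨t, ht⟩ := exists_dist_add (hz g List.mem_cons_self)
      ((shear_smul_mem_rightSide s g w').2 h1)
    have h2 : dist (g.line t) (shear s g • w') = dist (g.line (t - s)) w' := by
      rw [← dist_smul (shear s g) (g.line (t - s)), shear_smul_line]
      congr 2; ring
    have h3 := ih (z := g.line (t - s)) (e := 0) hl.2 hε.2
      (fun k hk hm => notMem_leftSide_of_mem_rightSide hm
        ((hl.1 k hk).mem_leftSide fun h' => notMem_range_of_mem_rightSide h' ⟨_, rfl⟩))
      (fun f hf => hw f (List.mem_cons_of_mem g hf)) le_rfl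
      (fun k hk u => by rw [sub_zero]; exact hε.1 k hk _ _)
    rw [h2] at ht
    have h4 : dist z w ≤ dist z (g.line t) +
        (dist (g.line t) (g.line (t - s)) + dist (g.line (t - s)) w) :=
      (dist_triangle _ _ _).trans (add_le_add_right (dist_triangle _ _ _) _)
    rw [dist_line, sub_sub_cancel] at h4
    have h5 := hze g List.mem_cons_self t
    push_cast
    constructor <;> linarith [h3.1, h3.2]

end IsomPlus

namespace HyperbolicSurface

open IsomPlus

variable {G : Type*} [Group G]

namespace ClosedGeodesic

variable {X : HyperbolicSurface G} (x : X.ClosedGeodesic)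

/-! ### The twist cocycle -/

open Classical in
/-- The relative displacement of the two pieces adjacent along a lift: the translation along the
lift by the distance `s` to the left, as seen from the half-plane `H` bounded by it.  It does not
depend on the chosen frame of the lift, see `wallShear_half`; sets not bounded by a lift get the
value `1`. -/
def wallShear (s : ℝ) (H : Set x.Off) : IsomPlus :=
  if h : ∃ g ∈ x.frames, x.half g = H then shear s h.choose else 1

variable {x}

theorem wallShear_half (hx : x.IsSimple) (s : ℝ) {g : IsomPlus} (hg : g ∈ x.frames) :
    x.wallShear s (x.half g) = shear s g := by
  have h : ∃ k ∈ x.frames, x.half k = x.half g := ⟨g, hg, rfl⟩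
  rw [wallShear, dif_pos h]
  obtain ⟨r, hr⟩ := exists_translation_of_half_eq hx h.choose_spec.1 hg h.choose_spec.2
  conv_rhs => rw [hr]
  rw [shear_mul_translation]

theorem wallShear_compl (hx : x.IsSimple) (s : ℝ) :
    ∀ H ∈ (walls hx).halfSpaces, x.wallShear s Hᶜ = (x.wallShear s H)⁻¹ := by
  rintro _ ⟨g, hg, rfl⟩
  rw [← half_mul_halfTurn hg, wallShear_half hx s hg,
    wallShear_half hx s (mul_halfTurn_mem_frames hg), shear_mul_halfTurn, shear_neg]

/-- The displacement of the piece of `w` relative to the piece of `z` in the twist deformation. -/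
def twistCocycle (hx : x.IsSimple) (s : ℝ) (z w : x.Off) : IsomPlus :=
  (walls hx).cocycle (x.wallShear s) z w

theorem twistCocycle_mul (hx : x.IsSimple) (s : ℝ) (z w v : x.Off) :
    twistCocycle hx s z w * twistCocycle hx s w v = twistCocycle hx s z v :=
  WallSpace.cocycle_mul (wallShear_compl hx s) z w v

theorem twistCocycle_self (hx : x.IsSimple) (s : ℝ) (z : x.Off) : twistCocycle hx s z z = 1 :=
  WallSpace.cocycle_self z

theorem mem_sep_half (hx : x.IsSimple) {z w : x.Off} {g : IsomPlus} (hg : g ∈ x.frames) :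
    x.half g ∈ (walls hx).sep z w ↔ (z : ℍ) ∈ g.leftSide ∧ (w : ℍ) ∈ g.rightSide :=
  ⟨fun h => ⟨h.2.1, (notMem_half hg).1 h.2.2⟩, fun h => ⟨⟨g, hg, rfl⟩, h.1, (notMem_half hg).2 h.2⟩⟩

theorem before_of_half_ssubset (hx : x.IsSimple) {z w : x.Off} {g k : IsomPlus} (hg : g ∈ x.frames)
    (hk : k ∈ x.frames) (h : x.half g ∈ (walls hx).sep z w) (h' : x.half k ∈ (walls hx).sep z w)
    (hlt : x.half g ⊂ x.half k) : Before g k := by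
  rw [mem_sep_half hx hg] at h
  rw [mem_sep_half hx hk] at h'
  rcases trichotomy_of_separates hx hg hk h.1 h.2 h'.1 h'.2 with ⟨r, rfl⟩ | h | h
  · rw [half_mul_translation] at hlt
    exact absurd hlt (ssubset_irrefl _)
  · exact h
  · exact absurd hlt (half_subset_of_before h).not_gt

/-- The lifts crossed on the way from `z` to `w`, in this order, and oriented such that `z` is on
their left. -/
theorem exists_chain (hx : x.IsSimple) (z w : x.Off) : ∃ l : List IsomPlus,
    l.Pairwise Before ∧
    (∀ g ∈ l, g ∈ x.frames ∧ (z : ℍ) ∈ g.leftSide ∧ (w : ℍ) ∈ g.rightSide) ∧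
    (∀ g ∈ x.frames, (z : ℍ) ∈ g.leftSide → (w : ℍ) ∈ g.rightSide →
      ∃ k ∈ l, ∃ r, g = k * translation r) ∧
    ∀ s, twistCocycle hx s z w = (l.map (shear s)).prod := by
  obtain ⟨L, hL⟩ := (walls hx).exists_sepList z w
  have hex : ∀ H : Set x.Off, ∃ g : IsomPlus, H ∈ (walls hx).sep z w → g ∈ x.frames ∧ x.half g =
      H := by
    intro H
    by_cases h : H ∈ (walls hx).sep z w
    · obtain ⟨g, hg, hgH⟩ := h.1
      exact ⟨g, fun _ => ⟨hg, hgH⟩⟩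
    · exact ⟨1, fun h' => absurd h' h⟩
  choose fr hfr using hex
  have hfr' : ∀ H ∈ L, H ∈ (walls hx).sep z w ∧ fr H ∈ x.frames ∧ x.half (fr H) = H := fun H hH =>
    ⟨(hL.2 H).1 hH, hfr H ((hL.2 H).1 hH)⟩
  refine ⟨L.map fr, ?_, ?_, ?_, fun s => ?_⟩
  · rw [List.pairwise_map]
    refine hL.1.imp_of_mem fun {H K} hH hK hHK => ?_
    obtain ⟨h1, h2, h3⟩ := hfr' H hH
    obtain ⟨h1', h2', h3'⟩ := hfr' K hK
    exact before_of_half_ssubset hx h2 h2' (h3.symm ▸ h1) (h3'.symm ▸ h1') (by rwa [h3, h3'])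
  · intro g hg
    rw [List.mem_map] at hg
    obtain ⟨H, hH, rfl⟩ := hg
    obtain ⟨h1, h2, h3⟩ := hfr' H hH
    exact ⟨h2, (mem_sep_half hx h2).1 (h3.symm ▸ h1)⟩
  · intro g hg hz hw
    have h1 := (hL.2 _).2 ((mem_sep_half hx hg).2 ⟨hz, hw⟩)
    obtain ⟨-, h2, h3⟩ := hfr' _ h1
    exact ⟨_, List.mem_map_of_mem h1, exists_translation_of_half_eq hx h2 hg h3⟩
  · rw [twistCocycle, WallSpace.cocycle_eq hL, List.map_map]
    congr 1
    refine List.map_congr_left fun H hH => ?_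
    obtain ⟨-, h2, h3⟩ := hfr' H hH
    rw [Function.comp_apply, ← wallShear_half hx s h2, h3]

variable (x) in
/-- The action of the deck group on the complement of the lifts. -/
def offPerm (γ : G) : x.Off ≃ x.Off where
  toFun z := ⟨X.hol γ • (z : ℍ), fun h => z.2 ((hol_smul_mem_preimage γ).1 h)⟩
  invFun z := ⟨(X.hol γ)⁻¹ • (z : ℍ), fun h => z.2 (by
    rwa [← map_inv, hol_smul_mem_preimage] at h)⟩
  left_inv z := Subtype.ext (inv_smul_smul _ _)
  right_inv z := Subtype.ext (smul_inv_smul _ _)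

@[simp] theorem coe_offPerm (γ : G) (z : x.Off) : ((x.offPerm γ z : x.Off) : ℍ) = X.hol γ •
    (z : ℍ) :=
  rfl

theorem offPerm_mul (γ δ : G) (z : x.Off) : x.offPerm (γ * δ) z = x.offPerm γ (x.offPerm δ z) :=
  Subtype.ext (by simp [mul_smul])

theorem offPerm_one (z : x.Off) : x.offPerm 1 z = z := Subtype.ext (by simp)

theorem image_half (γ : G) (g : IsomPlus) :
    x.offPerm γ '' x.half g = x.half (X.hol γ * g) := by
  ext z
  constructor
  · rintro ⟨w, hw, rfl⟩
    exact (smul_mem_leftSide (X.hol γ) g w).2 hw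
  · intro hz
    refine ⟨(x.offPerm γ).symm z, ?_, Equiv.apply_symm_apply _ _⟩
    have : X.hol γ • ((((x.offPerm γ).symm z : x.Off)) : ℍ) = z := by
      rw [← coe_offPerm, Equiv.apply_symm_apply]
    show _ ∈ g.leftSide
    rw [← smul_mem_leftSide (X.hol γ), this]
    exact hz

theorem twistCocycle_offPerm (hx : x.IsSimple) (s : ℝ) (γ : G) (z w : x.Off) :
    twistCocycle hx s (x.offPerm γ z) (x.offPerm γ w) =
      X.hol γ * twistCocycle hx s z w * (X.hol γ)⁻¹ := by
  have himg : ∀ γ : G, ∀ H ∈ (walls hx).halfSpaces, x.offPerm γ '' H ∈ (walls hx).halfSpaces := by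
    rintro γ _ ⟨g, hg, rfl⟩
    exact ⟨_, hol_mul_mem_frames γ hg, (image_half γ g).symm⟩
  refine WallSpace.cocycle_map (x.offPerm γ) (MulAut.conj (X.hol γ)).toMonoidHom (fun H => ?_)
    (fun H hH => ?_) z w
  · refine ⟨fun h => ?_, himg γ H⟩
    have := himg γ⁻¹ _ h
    rw [← Set.image_comp] at this
    have hid : (x.offPerm γ⁻¹ : x.Off → x.Off) ∘ x.offPerm γ = id := by
      funext v
      rw [Function.comp_apply, ← offPerm_mul, inv_mul_cancel, offPerm_one, id]
    rwa [hid, Set.image_id] at this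
  · obtain ⟨g, hg, rfl⟩ := hH
    rw [image_half, wallShear_half hx s hg, wallShear_half hx s (hol_mul_mem_frames γ hg),
        mul_shear]
    rfl

/-! ### Existence of the twist deformation -/

/-- The holonomy of the twist deformation, normalized such that the piece of `z₀` is not moved. -/
def twistHol (hx : x.IsSimple) (s : ℝ) (z₀ : x.Off) : G →* IsomPlus where
  toFun γ := twistCocycle hx s z₀ (x.offPerm γ z₀) * X.hol γ
  map_one' := by rw [offPerm_one, twistCocycle_self, map_one, one_mul]
  map_mul' γ δ := by
    rw [offPerm_mul, ← twistCocycle_mul hx s z₀ (x.offPerm γ z₀), twistCocycle_offPerm, map_mul]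
    group

theorem twistHol_apply (hx : x.IsSimple) (s : ℝ) (z₀ : x.Off) (γ : G) :
    twistHol hx s z₀ γ = twistCocycle hx s z₀ (x.offPerm γ z₀) * X.hol γ := rfl

/-- Only finitely many deck transformations of the twisted surface move the base point by a bounded
distance. -/
theorem finite_dist_twistHol_le (hx : x.IsSimple) (s : ℝ) (z₀ : x.Off) (R : ℝ) :
    {γ : G | dist (z₀ : ℍ) (twistHol hx s z₀ γ • (z₀ : ℍ)) ≤ R}.Finite := by
  obtain ⟨ε, hε, H⟩ := exists_separation hx
  set R' := R + (R + ε) / ε * |s| with hR'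
  refine (X.properlyDiscontinuous _ (isCompact_closedBall (z₀ : ℍ) (max R' 0))).subset ?_
  intro γ hγ
  refine ⟨z₀, Metric.mem_closedBall_self (le_max_right _ _), ?_⟩
  rw [Metric.mem_closedBall, dist_comm]
  refine le_trans ?_ (le_max_left _ _)
  rw [Set.mem_ofPred_eq, twistHol_apply, mul_smul] at hγ
  obtain ⟨l, hl, hl2, -, hls⟩ := exists_chain hx z₀ (x.offPerm γ z₀)
  have hsep : l.Pairwise fun g k => ∀ t u, ε ≤ dist (g.line t) (k.line u) := by
    refine hl.imp_of_mem fun {g k} hg hk h => ?_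
    rcases H g (hl2 g hg).1 k (hl2 k hk).1 with h' | h'
    · exact absurd (h'.range_eq ▸ ⟨0, rfl⟩)
        (notMem_range_of_mem_rightSide (line_mem_rightSide_of_before h 0))
    · exact h'
  obtain ⟨h1, h2⟩ := dist_shears (s := s) (e := ε) hl hsep (z := z₀) (w := x.offPerm γ z₀)
    (fun k hk h => notMem_leftSide_of_mem_rightSide h (hl2 k hk).2.1)
    (fun k hk => (hl2 k hk).2.2) hε.le (fun k _ u => by rw [sub_self]; exact dist_nonneg)
  rw [← hls, coe_offPerm] at h1 h2
  have h3 : (l.length : ℝ) ≤ (R + ε) / ε := by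
    rw [le_div_iff₀ hε]; linarith
  have h4 : (l.length : ℝ) * |s| ≤ (R + ε) / ε * |s| := by gcongr
  linarith

/-- The twisted surface. It has the properties required of a hyperbolic surface because the orbits
of a base point in the original and in the twisted action are comparable. -/
def twist (hx : x.IsSimple) (s : ℝ) (z₀ : x.Off) : HyperbolicSurface G :=
  have hpd : ∀ K : Set ℍ, IsCompact K →
      {γ : G | ∃ z ∈ K, twistHol hx s z₀ γ • z ∈ K}.Finite := by
    intro K hK
    obtain ⟨R, hR⟩ := hK.isBounded.subset_closedBall (z₀ : ℍ)
    refine (finite_dist_twistHol_le hx s z₀ (R + R)).subset ?_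
    rintro γ ⟨z, hz, hγz⟩
    have h1 := hR hz
    have h2 := hR hγz
    rw [Metric.mem_closedBall] at h1 h2
    refine (dist_triangle _ (twistHol hx s z₀ γ • z) _).trans (add_le_add ?_ ?_)
    · rwa [dist_comm]
    · rwa [IsomPlus.dist_smul]
  { hol := twistHol hx s z₀
    properlyDiscontinuous := hpd
    free := by
      -- The powers of an element with a fixed point are finite in number, so it has finite order
      -- and also fixes a point in the action of the original surface.
      intro γ z hz
      have hfin := hpd {z} isCompact_singleton
      have hmem : ∀ n : ℕ, γ ^ n ∈ {γ : G | ∃ w ∈ ({z} : Set ℍ), twistHol hx s z₀ γ • w ∈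
          ({z} : Set ℍ)} := by
        intro n
        refine ⟨z, rfl, ?_⟩
        rw [Set.mem_singleton_iff, map_pow]
        induction n with
        | zero => simp
        | succ n ih => rw [pow_succ, mul_smul, hz, ih]
      have hord : IsOfFinOrder γ := by
        by_contra hne
        exact (Set.infinite_of_injective_forall_mem
            (injective_pow_iff_not_isOfFinOrder.2 hne) hmem) hfin
      obtain ⟨n, hn, h⟩ := isOfFinOrder_iff_pow_eq_one.1 hord
      obtain ⟨w, hw⟩ := exists_fixed_of_pow_eq_one hn (g := X.hol γ) (by rw [← map_pow, h, map_one])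
      exact X.free γ w hw }

theorem nonempty_off (hx : x.IsSimple) : Nonempty x.Off :=
  let ⟨z, hz, _⟩ := exists_off_leftSide hx (x.lift_mem_frames 1)
  ⟨⟨z, hz⟩⟩

theorem twistCocycle_eq_one (hx : x.IsSimple) (s : ℝ) {z w : x.Off}
    (h : ∀ g ∈ x.frames, ¬((z : ℍ) ∈ g.leftSide ∧ (w : ℍ) ∈ g.rightSide)) :
    twistCocycle hx s z w = 1 := by
  obtain ⟨l, -, hl, -, hls⟩ := exists_chain hx z w
  have : l = [] := List.eq_nil_iff_forall_not_mem.2 fun g hg => h g (hl g hg).1 (hl g hg).2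
  rw [hls, this]; rfl

/-- If only one lift separates two points, the cocycle is the translation along it. -/
theorem twistCocycle_eq_shear (hx : x.IsSimple) (s : ℝ) {z w : x.Off} {g : IsomPlus}
    (hg : g ∈ x.frames) (hz : (z : ℍ) ∈ g.leftSide) (hw : (w : ℍ) ∈ g.rightSide)
    (h : ∀ k ∈ x.frames, (z : ℍ) ∈ k.leftSide → (w : ℍ) ∈ k.rightSide →
      Set.range k.line = Set.range g.line) :
    twistCocycle hx s z w = shear s g := by
  have hE : WallSpace.Enumerates [x.half g] ((walls hx).sep z w) := by
    refine ⟨List.pairwise_singleton _ _, fun H => ?_⟩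
    rw [List.mem_singleton]
    constructor
    · rintro rfl
      exact (mem_sep_half hx hg).2 ⟨hz, hw⟩
    · intro hH
      obtain ⟨k, hk, rfl⟩ := hH.1
      obtain ⟨h1, h2⟩ := (mem_sep_half hx hk).1 hH
      have hr := h k hk h1 h2
      rcases trichotomy_of_separates hx hg hk hz hw h1 h2 with ⟨r, rfl⟩ | h' | h'
      · rw [half_mul_translation]
      · exact absurd (hr ▸ ⟨0, rfl⟩)
          (notMem_range_of_mem_rightSide (line_mem_rightSide_of_before h' 0))
      · exact absurd (hr ▸ ⟨0, rfl⟩)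
          (notMem_range_of_mem_leftSide (line_mem_leftSide_of_before h' 0))
  rw [twistCocycle, WallSpace.cocycle_eq hE]
  simp [wallShear_half hx s hg]

open Classical in
theorem isLeftTwist_twist (hx : x.IsSimple) (s : ℝ) (z₀ : x.Off) :
    IsLeftTwist x s (twist hx s z₀) := by
  have hsepR : ∀ {g : IsomPlus} {z w : ℍ}, g ∈ x.frames → z ∈ g.leftSide → w ∈ g.rightSide →
      ∃ γ, (x.lift γ).Separates z w ∧ Set.range g.line = Set.range (x.lift γ).line := by
    rintro g z w ⟨γ, rfl | rfl⟩ hz hw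
    · exact ⟨γ, Or.inr ⟨hz, hw⟩, rfl⟩
    · rw [leftSide_mul_halfTurn] at hz
      rw [rightSide_mul_halfTurn] at hw
      exact ⟨γ, Or.inl ⟨hz, hw⟩, range_line_mul_halfTurn _⟩
  refine ⟨fun z => if h : z ∉ x.preimage then twistCocycle hx s z₀ ⟨z, h⟩ else 1, ?_, ?_, ?_⟩
  · intro z w hz hw H
    beta_reduce
    rw [dif_pos hz, dif_pos hw, ← twistCocycle_mul hx s z₀ ⟨z, hz⟩ ⟨w, hw⟩,
      twistCocycle_eq_one hx s (z := ⟨z, hz⟩) (w := ⟨w, hw⟩), mul_one]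
    rintro g hg ⟨h1, h2⟩
    obtain ⟨γ, h, -⟩ := hsepR hg h1 h2
    exact H γ h
  · intro γ z w hz hw hzr hwl H
    beta_reduce
    rw [dif_pos hz, dif_pos hw, ← twistCocycle_mul hx s z₀ ⟨z, hz⟩ ⟨w, hw⟩, inv_mul_cancel_left,
      twistCocycle_eq_shear hx s (mul_halfTurn_mem_frames (x.lift_mem_frames γ))
        (by rwa [leftSide_mul_halfTurn]) (by rwa [rightSide_mul_halfTurn]), shear_mul_halfTurn,
            shear]
    intro k hk h1 h2
    obtain ⟨δ, h3, h4⟩ := hsepR hk h1 h2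
    rw [h4, H δ h3, range_line_mul_halfTurn]
  · intro γ z hz
    have hz' : X.hol γ • z ∉ x.preimage := by rwa [hol_smul_mem_preimage]
    beta_reduce
    rw [dif_pos hz, dif_pos hz']
    show _ = twistHol hx s z₀ γ * _
    rw [twistHol_apply, ← twistCocycle_mul hx s z₀ (x.offPerm γ z₀),
      show (⟨X.hol γ • z, hz'⟩ : x.Off) = x.offPerm γ ⟨z, hz⟩ from rfl, twistCocycle_offPerm]
    group

end ClosedGeodesic
end HyperbolicSurface

namespace HyperbolicSurface

open IsomPlus

variable {G : Type*} [Group G]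

namespace ClosedGeodesic

variable {X : HyperbolicSurface G} {x : X.ClosedGeodesic}

/-! ### Uniqueness of the twist deformation -/

/-- Between two lifts that separate `z` and `w` there is a point off the lifts on the geodesic from
`z` to `w`; passing through it splits the set of half-planes that separate `z` and `w`. -/
theorem exists_sep_ssubset (hx : x.IsSimple) {z w : x.Off} {g k : IsomPlus} (hg : g ∈ x.frames)
    (hk : k ∈ x.frames) (h : Before g k) (hzg : (z : ℍ) ∈ g.leftSide) (hwg : (w : ℍ) ∈ g.rightSide)
    (hzk : (z : ℍ) ∈ k.leftSide) (hwk : (w : ℍ) ∈ k.rightSide) :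
    ∃ v : x.Off, (walls hx).sep z v ⊂ (walls hx).sep z w ∧
      (walls hx).sep v w ⊂ (walls hx).sep z w := by
  obtain ⟨l, hl0, hl1⟩ := exists_line_through z w
  have hd : 0 < dist (z : ℍ) w := by
    rw [dist_pos]; intro he
    rw [← he] at hwg
    exact notMem_leftSide_of_mem_rightSide hwg hzg
  obtain ⟨tg, -, -, htg, hcg⟩ := exists_crossing hd (hl0.symm ▸ hzg) (by rwa [hl1])
  obtain ⟨tk, -, htk1, htk, hck⟩ := exists_crossing hd (hl0.symm ▸ hzk) (by rwa [hl1])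
  have hlt : tg < tk := by
    have h1 : l.line tg ∈ k.leftSide :=
      h.mem_leftSide fun h' => notMem_range_of_mem_rightSide h' htg
    by_contra! hle
    rcases hle.eq_or_lt with rfl | hlt
    · exact notMem_range_of_mem_leftSide h1 htk
    · exact notMem_leftSide_of_mem_rightSide ((hck tg).2 hlt) h1
  obtain ⟨v, hv1, hv2, hv⟩ := exists_notMem_preimage
    (not_sameLine_of_notMem (k := l) (t := 0) (by rw [hl0]; exact z.2)) hlt
  have hv0 : 0 < v := by
    by_contra! hle
    have : l.line 0 ∈ g.rightSide := (hcg 0).2 (by linarith)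
    rw [hl0] at this
    exact notMem_leftSide_of_mem_rightSide this hzg
  have hv3 : v < dist (z : ℍ) w := hv2.trans htk1
  refine ⟨⟨l.line v, hv⟩, ?_, ?_⟩
  · refine LE.le.ssubset_of_ne ?_ fun he => ?_
    · rintro _ ⟨⟨f, hf, rfl⟩, hH⟩
      rw [notMem_half hf] at hH
      obtain ⟨r, hr1, hr2, -, hr⟩ := exists_crossing (g := f) hv0 (hl0.symm ▸ hH.1) hH.2
      refine ⟨⟨f, hf, rfl⟩, hH.1, (notMem_half hf).2 ?_⟩
      rw [← hl1]
      exact (hr _).2 (hr2.trans hv3)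
    · have := he.symm ▸ (mem_sep_half hx hk).2 ⟨hzk, hwk⟩
      exact notMem_leftSide_of_mem_rightSide ((mem_sep_half hx hk).1 this).2 ((hck v).1 hv2)
  · refine LE.le.ssubset_of_ne ?_ fun he => ?_
    · rintro _ ⟨⟨f, hf, rfl⟩, hH⟩
      rw [notMem_half hf] at hH
      obtain ⟨r, hr1, hr2, -, hr⟩ := exists_crossing (g := f) hv3 hH.1 (by rw [hl1]; exact hH.2)
      refine ⟨⟨f, hf, rfl⟩, ?_, (notMem_half hf).2 hH.2⟩
      show (z : ℍ) ∈ f.leftSide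
      rw [← hl0]
      exact (hr _).1 (hv0.trans hr1)
    · have := he.symm ▸ (mem_sep_half hx hg).2 ⟨hzg, hwg⟩
      exact notMem_leftSide_of_mem_rightSide ((hcg v).2 hv1) ((mem_sep_half hx hg).1 this).1

/-- In any twist deformation the relative displacement of two pieces is given by the cocycle. -/
theorem exists_placement (hx : x.IsSimple) {s : ℝ} {Y : HyperbolicSurface G}
    (h : IsLeftTwist x s Y) : ∃ E : x.Off → IsomPlus,
      (∀ z w, (E z)⁻¹ * E w = twistCocycle hx s z w) ∧
      ∀ γ z, E (x.offPerm γ z) * X.hol γ = Y.hol γ * E z := by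
  obtain ⟨E, hE1, hE2, hE3⟩ := h
  refine ⟨fun z => E z, fun z w => ?_, fun γ z => hE3 γ z z.2⟩
  induction hn : ((walls hx).sep z w).ncard using Nat.strong_induction_on generalizing z w with
  | _ n ih =>
  subst hn
  by_cases h0 : ∀ g ∈ x.frames, ¬((z : ℍ) ∈ g.leftSide ∧ (w : ℍ) ∈ g.rightSide)
  · rw [twistCocycle_eq_one hx s h0, inv_mul_eq_one]
    refine hE1 z w z.2 w.2 fun γ => ?_
    rintro (⟨h1, h2⟩ | ⟨h1, h2⟩)
    · exact h0 _ (mul_halfTurn_mem_frames (x.lift_mem_frames γ))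
        ⟨by rwa [leftSide_mul_halfTurn], by rwa [rightSide_mul_halfTurn]⟩
    · exact h0 _ (x.lift_mem_frames γ) ⟨h1, h2⟩
  push Not at h0
  obtain ⟨g, hg, hzg, hwg⟩ := h0
  by_cases h1 : ∀ k ∈ x.frames, (z : ℍ) ∈ k.leftSide → (w : ℍ) ∈ k.rightSide →
      Set.range k.line = Set.range g.line
  · rw [twistCocycle_eq_shear hx s hg hzg hwg h1]
    have hsep : ∀ δ, (x.lift δ).Separates z w → Set.range (x.lift δ).line = Set.range g.line := by
      rintro δ (⟨h2, h3⟩ | ⟨h2, h3⟩)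
      · rw [← h1 _ (mul_halfTurn_mem_frames (x.lift_mem_frames δ))
          (by rwa [leftSide_mul_halfTurn]) (by rwa [rightSide_mul_halfTurn]),
              range_line_mul_halfTurn]
      · exact h1 _ (x.lift_mem_frames δ) h2 h3
    obtain ⟨γ, rfl | rfl⟩ := hg
    · have := hE2 γ w z w.2 z.2 hwg hzg fun δ hδ => hsep δ (by
        rcases hδ with hδ | hδ
        · exact Or.inr ⟨hδ.2, hδ.1⟩
        · exact Or.inl ⟨hδ.2, hδ.1⟩)
      rw [← inv_inj, mul_inv_rev, inv_inv, this, ← shear_neg]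
      rfl
    · rw [leftSide_mul_halfTurn] at hzg
      rw [rightSide_mul_halfTurn] at hwg
      rw [shear_mul_halfTurn]
      refine hE2 γ z w z.2 w.2 hzg hwg fun δ hδ => ?_
      rw [hsep δ hδ, range_line_mul_halfTurn]
  · push Not at h1
    obtain ⟨k, hk, hzk, hwk, hne⟩ := h1
    obtain ⟨v, hv1, hv2⟩ : ∃ v : x.Off, (walls hx).sep z v ⊂ (walls hx).sep z w ∧
        (walls hx).sep v w ⊂ (walls hx).sep z w := by
      rcases trichotomy_of_separates hx hg hk hzg hwg hzk hwk with ⟨r, rfl⟩ | h | h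
      · exact absurd (range_line_mul_translation _ _) hne
      · exact exists_sep_ssubset hx hg hk h hzg hwg hzk hwk
      · exact exists_sep_ssubset hx hk hg h hzk hwk hzg hwg
    have hfin : ((walls hx).sep z w).Finite := (walls hx).finite_sep z w
    rw [← twistCocycle_mul hx s z v w, ← ih _ (Set.ncard_lt_ncard hv1 hfin) z v rfl,
      ← ih _ (Set.ncard_lt_ncard hv2 hfin) v w rfl]
    group

end ClosedGeodesic
end HyperbolicSurface

namespace IsomPlus

/-! ### Fixed points of positive matrices -/

/-- All entries of the matrix are nonnegative. -/
def Nonneg (m : SL(2, ℝ)) : Prop := 0 ≤ m 0 0 ∧ 0 ≤ m 0 1 ∧ 0 ≤ m 1 0 ∧ 0 ≤ m 1 1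

theorem Pos.nonneg {m : SL(2, ℝ)} (h : Pos m) : Nonneg m :=
  ⟨h.1.le, h.2.1.le, h.2.2.1.le, h.2.2.2.le⟩

theorem Nonneg.mul {m n : SL(2, ℝ)} (hm : Nonneg m) (hn : Nonneg n) : Nonneg (m * n) := by
  obtain ⟨a, b, c, d⟩ := hm
  obtain ⟨a', b', c', d'⟩ := hn
  refine ⟨?_, ?_, ?_, ?_⟩ <;> rw [mul_apply] <;> positivity

theorem nonneg_diag (r : ℝ) : Nonneg (diag r) := by
  refine ⟨?_, ?_, ?_, ?_⟩ <;> simp [diag] <;> positivity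

theorem Nonneg.num_pos {m : SL(2, ℝ)} (hm : Nonneg m) {r : ℝ} (hr : 0 < r) :
    0 < m 0 0 * r + m 0 1 := by
  obtain ⟨a, b, c, d⟩ := hm
  by_contra! h
  have h1 : 0 ≤ m 0 0 * r := by positivity
  have h2 : m 0 1 = 0 := by linarith
  have h3 : m 0 0 = 0 := (mul_eq_zero.1 (by linarith : m 0 0 * r = 0)).resolve_right hr.ne'
  have := det_eq m
  rw [h2, h3] at this
  norm_num at this

theorem Nonneg.denom_pos {m : SL(2, ℝ)} (hm : Nonneg m) {r : ℝ} (hr : 0 < r) :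
    0 < m 1 0 * r + m 1 1 := by
  obtain ⟨a, b, c, d⟩ := hm
  by_contra! h
  have h1 : 0 ≤ m 1 0 * r := by positivity
  have h2 : m 1 1 = 0 := by linarith
  have h3 : m 1 0 = 0 := (mul_eq_zero.1 (by linarith : m 1 0 * r = 0)).resolve_right hr.ne'
  have := det_eq m
  rw [h2, h3] at this
  norm_num at this

/-- The action of a matrix on the boundary `ℝ ∪ {∞}`, used on positive numbers only. -/
def act (m : SL(2, ℝ)) (r : ℝ) : ℝ := (m 0 0 * r + m 0 1) / (m 1 0 * r + m 1 1)

theorem Nonneg.act_pos {m : SL(2, ℝ)} (hm : Nonneg m) {r : ℝ} (hr : 0 < r) : 0 < act m r :=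
  div_pos (hm.num_pos hr) (hm.denom_pos hr)

theorem act_mul {m n : SL(2, ℝ)} (hm : Nonneg m) (hn : Nonneg n) {r : ℝ} (hr : 0 < r) :
    act (m * n) r = act m (act n r) := by
  have h1 := (hn.denom_pos hr).ne'
  have h2 := (hm.denom_pos (hn.act_pos hr)).ne'
  have h3 := ((hm.mul hn).denom_pos hr).ne'
  rw [act, act, div_eq_div_iff h3 h2]
  simp only [mul_apply, act]
  field_simp
  ring

theorem act_lt_act {m : SL(2, ℝ)} (hm : Nonneg m) {r r' : ℝ} (hr : 0 < r) (hlt : r < r') :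
    act m r < act m r' := by
  rw [act, act, div_lt_div_iff₀ (hm.denom_pos hr) (hm.denom_pos (hr.trans hlt))]
  have := det_eq m
  nlinarith

theorem act_le_act {m : SL(2, ℝ)} (hm : Nonneg m) {r r' : ℝ} (hr : 0 < r) (hle : r ≤ r') :
    act m r ≤ act m r' := by
  rcases hle.eq_or_lt with rfl | h
  · exact le_rfl
  · exact (act_lt_act hm hr h).le

theorem act_diag (s r : ℝ) : act (diag s) r = Real.exp s * r := by
  simp only [act, diag, mat_zero_zero, mat_zero_one, mat_one_zero, mat_one_one]
  rw [Real.exp_neg, zero_mul, zero_add, add_zero, div_inv_eq_mul, mul_right_comm, ← Real.exp_add,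
    add_halves]

/-- The conjugate of the inverse by the reflection `r ↦ -r`: it describes the action of the inverse
on the negative numbers. -/
def reflect (m : SL(2, ℝ)) : SL(2, ℝ) :=
  mat (m 1 1) (m 0 1) (m 1 0) (m 0 0) (by have := det_eq m; linarith)

theorem reflect_mul (m n : SL(2, ℝ)) : reflect (m * n) = reflect n * reflect m := by
  apply sl_ext <;> simp only [reflect, mul_apply, mat_zero_zero, mat_zero_one, mat_one_zero,
    mat_one_one] <;> ring

theorem reflect_diag (s : ℝ) : reflect (diag s) = diag (-s) := by
  apply sl_ext <;> simp [reflect, diag, neg_div]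

theorem reflect_one : reflect 1 = 1 := by
  apply sl_ext <;> simp [reflect]

theorem pos_reflect {m : SL(2, ℝ)} (hm : Pos m) : Pos (reflect m) :=
  ⟨hm.2.2.2, hm.2.1, hm.2.2.1, hm.1⟩

/-- The positive fixed point of a positive matrix `m`, by the quadratic formula. Accordingly, the
negative fixed point is `-fixedPos (reflect m)`. -/
def fixedPos (m : SL(2, ℝ)) : ℝ :=
  (m 0 0 - m 1 1 + √((m 0 0 - m 1 1) ^ 2 + 4 * m 0 1 * m 1 0)) / (2 * m 1 0)

section fixedPos

variable {m : SL(2, ℝ)} (hm : Pos m)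
include hm

theorem Pos.abs_lt_sqrt :
    |m 0 0 - m 1 1| < √((m 0 0 - m 1 1) ^ 2 + 4 * m 0 1 * m 1 0) := by
  obtain ⟨-, b, c, -⟩ := hm
  apply Real.lt_sqrt_of_sq_lt
  rw [sq_abs]
  have : 0 < 4 * m 0 1 * m 1 0 := by positivity
  linarith

theorem Pos.fixedPos_pos : 0 < fixedPos m := by
  have h := hm.abs_lt_sqrt
  have := neg_abs_le (m 0 0 - m 1 1)
  have hc := hm.2.2.1
  exact div_pos (by linarith) (by positivity)

theorem Pos.fixedPos_quadratic :
    m 1 0 * fixedPos m ^ 2 + (m 1 1 - m 0 0) * fixedPos m - m 0 1 = 0 := by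
  have hc := hm.2.2.1.ne'
  have hb := hm.2.1
  have h : √((m 0 0 - m 1 1) ^ 2 + 4 * m 0 1 * m 1 0) ^ 2 =
      (m 0 0 - m 1 1) ^ 2 + 4 * m 0 1 * m 1 0 := by
    apply Real.sq_sqrt
    have := hm.2.2.1
    positivity
  rw [fixedPos]
  generalize √((m 0 0 - m 1 1) ^ 2 + 4 * m 0 1 * m 1 0) = S at h ⊢
  field_simp
  linear_combination h

theorem Pos.fixedPos_sub : m 1 0 * (fixedPos m - fixedPos (reflect m)) = m 0 0 - m 1 1 := by
  have hc := hm.2.2.1.ne'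
  simp only [fixedPos, reflect, mat_zero_zero, mat_zero_one, mat_one_zero, mat_one_one]
  rw [show (m 1 1 - m 0 0) ^ 2 = (m 0 0 - m 1 1) ^ 2 by ring]
  field_simp
  ring

theorem Pos.act_fixedPos : act m (fixedPos m) = fixedPos m := by
  rw [act, div_eq_iff (hm.nonneg.denom_pos hm.fixedPos_pos).ne']
  linear_combination -hm.fixedPos_quadratic

/-- A positive matrix moves the positive numbers towards its positive fixed point. -/
theorem Pos.lt_fixedPos {r : ℝ} (hr : 0 < r) (h : r < act m r) : r < fixedPos m := by
  rw [act, lt_div_iff₀ (hm.nonneg.denom_pos hr)] at h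
  by_contra! hle
  have h1 := hm.fixedPos_quadratic
  have h2 := hm.fixedPos_pos
  obtain ⟨a, b, c, d⟩ := hm
  set p := fixedPos m
  have h3 : (m 1 0 * r + m 1 1 - m 0 0) * r < m 0 1 := by linarith
  have h4 : (m 1 0 * p + m 1 1 - m 0 0) * p = m 0 1 := by linarith
  have h5 : 0 < m 1 0 * p + m 1 1 - m 0 0 := by
    by_contra! h'
    nlinarith
  have h6 : m 1 0 * p ≤ m 1 0 * r := by gcongr
  nlinarith

/-- The weak form of `Pos.lt_fixedPos`. -/
theorem Pos.le_fixedPos {r : ℝ} (hr : 0 < r) (h : r ≤ act m r) : r ≤ fixedPos m := by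
  rcases h.lt_or_eq with h | h
  · exact (hm.lt_fixedPos hr h).le
  · by_contra! hlt
    rw [act, eq_div_iff (hm.nonneg.denom_pos hr).ne'] at h
    have h1 := hm.fixedPos_quadratic
    have h2 := hm.fixedPos_pos
    obtain ⟨a, b, c, d⟩ := hm
    set p := fixedPos m
    have h3 : (m 1 0 * r + m 1 1 - m 0 0) * r = m 0 1 := by linarith
    have h4 : (m 1 0 * p + m 1 1 - m 0 0) * p = m 0 1 := by linarith
    have h5 : 0 < m 1 0 * p + m 1 1 - m 0 0 := by
      by_contra! h'
      nlinarith
    have h6 : m 1 0 * p < m 1 0 * r := by gcongr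
    nlinarith

/-- The columns are eigenvectors: the endpoints of the axis of a positive matrix are its fixed
points, one positive and one negative. -/
theorem Pos.exists_axis : ∃ (κ len : ℝ)
    (h : (fixedPos m * κ) * κ - (-fixedPos (reflect m) * κ) * κ = 1),
    0 < κ ∧ 0 < len ∧ m * mat (fixedPos m * κ) (-fixedPos (reflect m) * κ) κ κ h =
      mat (fixedPos m * κ) (-fixedPos (reflect m) * κ) κ κ h * diag len := by
  have hP := hm.fixedPos_pos
  have hM := (pos_reflect hm).fixedPos_pos
  have qP := hm.fixedPos_quadratic
  have qM := (pos_reflect hm).fixedPos_quadratic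
  have hd := hm.fixedPos_sub
  simp only [reflect, mat_zero_zero, mat_zero_one, mat_one_zero, mat_one_one] at qM
  change m 1 0 * fixedPos (reflect m) ^ 2 + (m 0 0 - m 1 1) * fixedPos (reflect m) - m 0 1 = 0 at qM
  set P := fixedPos m
  set M := fixedPos (reflect m)
  have hdet := det_eq m
  obtain ⟨ha, hb, hc, hdd⟩ := hm
  set lam := m 1 0 * P + m 1 1 with hlam
  have hlam0 : 0 < lam := by positivity
  -- by the formula for the product of the roots of the quadratic equation
  have hprod : m 1 0 * (P * M) = m 0 1 := by
    have : (m 1 0 * (P * M) - m 0 1) * (P + M) = 0 := by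
      linear_combination M * qP + P * qM
    rcases mul_eq_zero.1 this with h | h
    · linarith
    · linarith
  have hmu : lam * (m 1 1 - m 1 0 * M) = 1 := by
    rw [hlam]
    linear_combination m 1 1 * hd - m 1 0 * hprod + hdet
  have hlam1 : 1 < lam := by
    by_contra! h
    have h1 : 0 < m 1 0 * (P + M) := by positivity
    have h2 : m 1 1 - m 1 0 * M < lam := by rw [hlam]; linarith
    nlinarith
  refine ⟨1 / √(P + M), 2 * Real.log lam, ?_, by positivity, by
    have := Real.log_pos hlam1; positivity, ?_⟩
  · have : (1 / √(P + M)) * (1 / √(P + M)) * (P + M) = 1 := by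
      rw [div_mul_div_comm, Real.mul_self_sqrt (by positivity)]
      field_simp
    linear_combination this
  · have he : Real.exp (2 * Real.log lam / 2) = lam := by
      rw [mul_div_cancel_left₀ _ two_ne_zero, Real.exp_log hlam0]
    have he' : Real.exp (-(2 * Real.log lam / 2)) = m 1 1 - m 1 0 * M := by
      rw [Real.exp_neg, he]
      exact inv_eq_of_mul_eq_one_right hmu
    apply sl_ext <;> simp only [mul_apply, diag, mat_zero_zero, mat_zero_one, mat_one_zero,
      mat_one_one, he, he']
    · rw [hlam]; linear_combination (-1 / √(P + M)) * qP
    · linear_combination (-1 / √(P + M)) * qM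
    · rw [hlam]; ring
    · ring

end fixedPos

/-! ### Monotonicity of products of positive matrices and translations -/

/-- The product of the matrices in the list, each followed by the translation by `s`. -/
def word (s : ℝ) (l : List SL(2, ℝ)) : SL(2, ℝ) := (l.map fun m => m * diag s).prod

theorem word_cons (s : ℝ) (m : SL(2, ℝ)) (l : List SL(2, ℝ)) :
    word s (m :: l) = m * diag s * word s l := by simp [word]

section word

variable {l : List SL(2, ℝ)} (hl : ∀ m ∈ l, Pos m)
include hl

theorem nonneg_word (s : ℝ) : Nonneg (word s l) := by
  induction l with
  | nil => refine ⟨?_, ?_, ?_, ?_⟩ <;> simp [word]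
  | cons m l ih =>
    rw [word_cons]
    exact ((hl m List.mem_cons_self).nonneg.mul (nonneg_diag s)).mul
      (ih fun n hn => hl n (List.mem_cons_of_mem m hn))

theorem pos_word (hne : l ≠ []) (s : ℝ) : Pos (word s l) := by
  induction l with
  | nil => exact absurd rfl hne
  | cons m l ih =>
    have h1 := (hl m List.mem_cons_self).mul_diag s
    rw [word_cons]
    rcases eq_or_ne l [] with rfl | h
    · simpa [word] using h1
    · exact h1.mul (ih (fun n hn => hl n (List.mem_cons_of_mem m hn)) h)

/-- As `exp s` increases with `s` and each matrix acts as an increasing function, so does the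
word. -/
theorem act_word_le {s s' r r' : ℝ} (hs : s ≤ s') (hr : 0 < r) (hrr : r ≤ r') :
    act (word s l) r ≤ act (word s' l) r' := by
  induction l with
  | nil => simpa [word, act] using hrr
  | cons m l ih =>
    have hl' : ∀ n ∈ l, Pos n := fun n hn => hl n (List.mem_cons_of_mem m hn)
    have hm := (hl m List.mem_cons_self).nonneg
    have hr' := hr.trans_le hrr
    have h0 := (nonneg_word hl' s).act_pos hr
    have h0' := (nonneg_word hl' s').act_pos hr'
    rw [word_cons, word_cons, act_mul (hm.mul (nonneg_diag s)) (nonneg_word hl' s) hr,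
      act_mul (hm.mul (nonneg_diag s')) (nonneg_word hl' s') hr', act_mul hm (nonneg_diag s) h0,
      act_mul hm (nonneg_diag s') h0', act_diag, act_diag]
    have := ih hl'
    exact act_le_act hm (by positivity) (by gcongr)

theorem act_word_lt (hne : l ≠ []) {s s' r : ℝ} (hs : s < s') (hr : 0 < r) :
    act (word s l) r < act (word s' l) r := by
  obtain ⟨m, l, rfl⟩ := List.exists_cons_of_ne_nil hne
  have hl' : ∀ n ∈ l, Pos n := fun n hn => hl n (List.mem_cons_of_mem m hn)
  have hm := (hl m List.mem_cons_self).nonneg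
  have h0 := (nonneg_word hl' s).act_pos hr
  have h0' := (nonneg_word hl' s').act_pos hr
  rw [word_cons, word_cons, act_mul (hm.mul (nonneg_diag s)) (nonneg_word hl' s) hr,
    act_mul (hm.mul (nonneg_diag s')) (nonneg_word hl' s') hr, act_mul hm (nonneg_diag s) h0,
    act_mul hm (nonneg_diag s') h0', act_diag, act_diag]
  have h1 := act_word_le hl' hs.le hr le_rfl
  have h2 := Real.exp_lt_exp.2 hs
  exact act_lt_act hm (by positivity) (by
    calc _ < Real.exp s' * act (word s l) r := by gcongr
      _ ≤ _ := by gcongr)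

theorem nonneg_reflect_word (s : ℝ) : Nonneg (reflect (word s l)) :=
  have h := nonneg_word hl s
  ⟨h.2.2.2, h.2.1, h.2.2.1, h.1⟩

/-- In the inverse of the word the translations go in the opposite direction. -/
theorem act_reflect_word_le {s s' r r' : ℝ} (hs : s ≤ s') (hr : 0 < r) (hrr : r ≤ r') :
    act (reflect (word s' l)) r ≤ act (reflect (word s l)) r' := by
  induction l generalizing r r' with
  | nil => simpa [word, reflect_one, act] using hrr
  | cons m l ih =>
    have hl' : ∀ n ∈ l, Pos n := fun n hn => hl n (List.mem_cons_of_mem m hn)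
    have hm := (pos_reflect (hl m List.mem_cons_self)).nonneg
    have hr' := hr.trans_le hrr
    have h1 := hm.act_pos hr
    have h2 := act_le_act hm hr hrr
    rw [word_cons, word_cons, reflect_mul, reflect_mul, reflect_mul, reflect_mul, reflect_diag,
        reflect_diag,
      act_mul (nonneg_reflect_word hl' s') ((nonneg_diag _).mul hm) hr,
      act_mul (nonneg_reflect_word hl' s) ((nonneg_diag _).mul hm) hr',
      act_mul (nonneg_diag _) hm hr, act_mul (nonneg_diag _) hm hr', act_diag, act_diag]
    exact ih hl' (by positivity) (by gcongr)

theorem fixedPos_word_lt (hne : l ≠ []) {s s' : ℝ} (hs : s < s') :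
    fixedPos (word s l) < fixedPos (word s' l) := by
  have h := pos_word hl hne s
  refine (pos_word hl hne s').lt_fixedPos h.fixedPos_pos ?_
  calc fixedPos (word s l) = act (word s l) (fixedPos (word s l)) := h.act_fixedPos.symm
    _ < _ := act_word_lt hl hne hs h.fixedPos_pos

theorem fixedPos_reflect_word_le (hne : l ≠ []) {s s' : ℝ} (hs : s ≤ s') :
    fixedPos (reflect (word s' l)) ≤ fixedPos (reflect (word s l)) := by
  have h := pos_reflect (pos_word hl hne s')
  refine (pos_reflect (pos_word hl hne s)).le_fixedPos h.fixedPos_pos ?_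
  calc _ = act (reflect (word s' l)) (fixedPos (reflect (word s' l))) := h.act_fixedPos.symm
    _ ≤ _ := act_reflect_word_le hl hs h.fixedPos_pos le_rfl

end word

/-- The angle, anticlockwise from the axis of a positive matrix to the imaginary axis, as a
function of the endpoints of the former. -/
def axisAngle (m : SL(2, ℝ)) : ℝ := 2 * Real.arctan √(fixedPos (reflect m) / fixedPos m)

theorem axisAngle_word_lt {l : List SL(2, ℝ)} (hl : ∀ m ∈ l, Pos m) (hne : l ≠ []) {s s' : ℝ}
    (hs : s < s') : axisAngle (word s' l) < axisAngle (word s l) := by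
  have h1 := fixedPos_word_lt hl hne hs
  have h2 := fixedPos_reflect_word_le hl hne hs.le
  have h3 := (pos_word hl hne s).fixedPos_pos
  have h3' := (pos_word hl hne s').fixedPos_pos
  have h4 := (pos_reflect (pos_word hl hne s')).fixedPos_pos
  unfold axisAngle
  have : √(fixedPos (reflect (word s' l)) / fixedPos (word s' l)) <
      √(fixedPos (reflect (word s l)) / fixedPos (word s l)) := by
    apply Real.sqrt_lt_sqrt (by positivity)
    calc _ < fixedPos (reflect (word s' l)) / fixedPos (word s l) := by gcongr
      _ ≤ _ := by gcongr
  have := Real.arctan_lt_arctan_iff.2 this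
  linarith

/-- Along a chain of frames the product of the translations is a word in positive matrices: with
`g i = g (i - 1) * m i`, the product of the elements `g i * translation s * (g i)⁻¹` telescopes. -/
theorem exists_word {l : List IsomPlus} {g k : IsomPlus}
    (hl : (g :: (l ++ [k])).Pairwise Before) : ∃ L : List SL(2, ℝ), L ≠ [] ∧ (∀ m ∈ L, Pos m) ∧
      ∀ s, ((l ++ [k]).map (shear s)).prod * k = g * moebius (word s L) := by
  induction l generalizing g with
  | nil =>
    obtain ⟨m, hm, rfl⟩ : Before g k := by simpa using hl
    refine ⟨[m], by simp, by simpa using hm, fun s => ?_⟩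
    simp [word, shear, translation_eq, mul_assoc]
  | cons f l ih =>
    rw [List.cons_append, List.pairwise_cons] at hl
    obtain ⟨L, hne, hL, h⟩ := ih hl.2
    obtain ⟨m, hm, rfl⟩ := hl.1 f List.mem_cons_self
    refine ⟨m :: L, by simp, by simpa using ⟨hm, hL⟩, fun s => ?_⟩
    rw [List.cons_append, List.map_cons, List.prod_cons, mul_assoc, h s, word_cons, map_mul,
        map_mul,
      ← translation_eq, shear]
    group

end IsomPlus

namespace IsomPlus

/-! ### The angle between two crossing geodesics -/

theorem hasDerivAt_line_one (t : ℝ) :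
    HasDerivAt (fun r : ℝ => ((1 : IsomPlus).line r : ℂ)) (Real.exp t * Complex.I) t := by
  have h : (fun r : ℝ => ((1 : IsomPlus).line r : ℂ)) = fun r : ℝ => (Real.exp r : ℂ) * Complex.I :=
      by
    funext r
    rw [line, one_smul, coe_translation_smul, UpperHalfPlane.coe_I]
  rw [h]
  exact ((Real.hasDerivAt_exp t).ofReal_comp).mul_const _

theorem denom_ne_zero (m : SL(2, ℝ)) (z : ℍ) : ((m 1 0 : ℝ) : ℂ) * z + (m 1 1 : ℝ) ≠ 0 := by
  intro h
  have h1 := denomSq_pos m z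
  have hre := congrArg Complex.re h
  have him := congrArg Complex.im h
  simp at hre him
  rw [denomSq, hre] at h1
  rcases him with h | h
  · rw [h] at h1; simp at h1
  · exact z.im_pos.ne' h

theorem hasDerivAt_moebius_smul (m : SL(2, ℝ)) {w : ℝ → ℍ} {w' : ℂ} {t : ℝ}
    (h : HasDerivAt (fun r => (w r : ℂ)) w' t) :
    HasDerivAt (fun r => ((moebius m • w r : ℍ) : ℂ))
      (w' / ((m 1 0 : ℝ) * (w t : ℂ) + (m 1 1 : ℝ)) ^ 2) t := by
  have hf : (fun r => ((moebius m • w r : ℍ) : ℂ)) = fun r =>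
      (((m 0 0 : ℝ) : ℂ) * w r + (m 0 1 : ℝ)) / (((m 1 0 : ℝ) : ℂ) * w r + (m 1 1 : ℝ)) := by
    funext r
    rw [moebius_smul, UpperHalfPlane.coe_specialLinearGroup_apply]
    rfl
  rw [hf]
  have hne := denom_ne_zero m (w t)
  have hdet : ((m 0 0 : ℝ) : ℂ) * (m 1 1 : ℝ) - (m 0 1 : ℝ) * (m 1 0 : ℝ) = 1 := by
    exact_mod_cast det_eq m
  refine (((h.const_mul _).add_const _).div ((h.const_mul _).add_const _) hne).congr_deriv ?_
  congr 1
  linear_combination w' * hdet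

theorem smul_line_one (g : IsomPlus) (t : ℝ) : g • (1 : IsomPlus).line t = g.line t := by
  rw [smul_line, mul_one]

/-- At a common point of two geodesics the quotient of the velocities depends only on the relative
position of the frames: the derivative of `F` cancels. -/
theorem velocity_ratio (F : IsomPlus) (m : SL(2, ℝ)) {t u : ℝ}
    (h : F.line t = (F * moebius m).line u) :
    deriv (fun r : ℝ => (F.line r : ℂ)) t / deriv (fun r : ℝ => ((F * moebius m).line r : ℂ)) u =
      (Real.exp (t - u) : ℂ) * (m 1 1 + m 1 0 * Real.exp u * Complex.I) ^ 2 := by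
  obtain ⟨n, rfl⟩ := moebius_surjective F
  have h1 := hasDerivAt_moebius_smul n (hasDerivAt_line_one t)
  have h2 := hasDerivAt_moebius_smul m (hasDerivAt_line_one u)
  have h3 := hasDerivAt_moebius_smul n h2
  simp only [smul_line_one] at h1
  simp only [smul_line, mul_one] at h3
  have hz : (1 : IsomPlus).line t = (moebius m).line u := by
    apply MulAction.injective (moebius n)
    beta_reduce
    rw [smul_line_one, smul_line]; exact h
  have hline : (((1 : IsomPlus).line u : ℍ) : ℂ) = Real.exp u * Complex.I := by
    rw [line, one_smul, coe_translation_smul, UpperHalfPlane.coe_I]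
  rw [h1.deriv, h3.deriv, ← hz]
  have hn := denom_ne_zero n ((1 : IsomPlus).line t)
  have hm := denom_ne_zero m ((1 : IsomPlus).line u)
  rw [hline] at hm ⊢
  have he : (Real.exp u : ℂ) ≠ 0 := by exact_mod_cast Real.exp_ne_zero u
  rw [Real.exp_sub, Complex.ofReal_div]
  field_simp
  ring

theorem deriv_line_mul_translation (g : IsomPlus) (v t : ℝ) :
    deriv (fun r : ℝ => ((g * translation v).line r : ℂ)) t =
      deriv (fun r : ℝ => (g.line r : ℂ)) (v + t) := by
  simp only [mul_translation_line]
  exact deriv_comp_const_add (f := fun r : ℝ => (g.line r : ℂ)) v t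

theorem deriv_line_mul_halfTurn (g : IsomPlus) (t : ℝ) :
    deriv (fun r : ℝ => ((g * halfTurn).line r : ℂ)) t =
      -deriv (fun r : ℝ => (g.line r : ℂ)) (-t) := by
  simp only [mul_halfTurn_line]
  exact deriv_comp_neg (f := fun r : ℝ => (g.line r : ℂ)) t

/-- Half of the argument is that of `d + c i`, which lies in the first quadrant. -/
theorem arg_sq_eq {c d ρ : ℝ} (hc : 0 < c) (hd : 0 < d) (hρ : 0 < ρ) :
    Complex.arg (ρ * (d + c * Complex.I) ^ 2) = 2 * Real.arctan (c / d) := by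
  have h0 := Real.arctan_pos.2 (div_pos hc hd)
  have h1 := Real.arctan_lt_pi_div_two (c / d)
  have hcos := Real.cos_arctan_pos (c / d)
  set θ := Real.arctan (c / d) with hθ
  have htan : Real.sin θ / Real.cos θ = c / d := by
    rw [← Real.tan_eq_sin_div_cos, hθ, Real.tan_arctan]
  have hs : c * Real.cos θ = d * Real.sin θ := by
    rw [div_eq_div_iff hcos.ne' hd.ne'] at htan; linarith
  have hpolar : (d : ℂ) + c * Complex.I =
      (d / Real.cos θ : ℝ) * (Complex.cos θ + Complex.sin θ * Complex.I) := by
    rw [← Complex.ofReal_cos, ← Complex.ofReal_sin]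
    have e1 : d / Real.cos θ * Real.cos θ = d := by field_simp
    have e2 : d / Real.cos θ * Real.sin θ = c := by field_simp; linarith
    rw [mul_add, ← mul_assoc, ← Complex.ofReal_mul, ← Complex.ofReal_mul, e1, e2]
  have h2 : (ρ : ℂ) * (d + c * Complex.I) ^ 2 =
      ((ρ * (d / Real.cos θ) ^ 2 : ℝ) : ℂ) *
        (Complex.cos ((2 * θ : ℝ) : ℂ) + Complex.sin ((2 * θ : ℝ) : ℂ) * Complex.I) := by
    rw [hpolar, mul_pow]
    push_cast
    have := Complex.cos_add_sin_mul_I_pow 2 (θ : ℂ)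
    push_cast at this
    rw [this]
    ring
  rw [h2, Complex.arg_mul_cos_add_sin_mul_I (by positivity)]
  constructor <;> linarith [Real.pi_pos]

/-- Reversing the orientation of one of the two geodesics does not change the angle modulo `π`. -/
theorem toIcoMod_arg {w : ℂ} {θ : ℝ} (h0 : 0 < θ) (h1 : θ < Real.pi) (h : Complex.arg w = θ) :
    toIcoMod Real.pi_pos 0 (Complex.arg w) = θ ∧ toIcoMod Real.pi_pos 0 (Complex.arg (-w)) = θ := by
  constructor
  · rw [h, toIcoMod_eq_self]
    exact ⟨h0.le, by linarith⟩
  · have him : 0 < w.im := by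
      rw [← Complex.norm_mul_sin_arg, h]
      have := Real.sin_pos_of_pos_of_lt_pi h0 h1
      have hw : w ≠ 0 := by rintro rfl; simp at h; linarith
      positivity
    rw [Complex.arg_neg_eq_arg_sub_pi_of_im_pos him, h, toIcoMod_sub, toIcoMod_eq_self]
    exact ⟨h0.le, by linarith⟩

/-- The angle from a geodesic with endpoints `-M < 0 < P` to the imaginary axis, with both
transported by the isometry `F`. -/
theorem anticlockwiseAngle_eq {F f k : IsomPlus} {P M κ : ℝ} (hP : 0 < P) (hM : 0 < M) (hκ : 0 < κ)
    (hdet : (P * κ) * κ - (-M * κ) * κ = 1) (hf : SameLine F f)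
    (hk : ∃ v, k = F * moebius (mat (P * κ) (-M * κ) κ κ hdet) * translation v) {t u : ℝ}
    (h : f.line t = k.line u) :
    HyperbolicSurface.anticlockwiseAngle f t k u = 2 * Real.arctan √(M / P) := by
  obtain ⟨v, rfl⟩ := hk
  set m := mat (P * κ) (-M * κ) κ κ hdet with hm
  rw [mul_translation_line] at h
  -- reduce to the case where the frame of the first geodesic is `F`
  obtain ⟨t', ht', hd⟩ : ∃ t', F.line t' = (F * moebius m).line (v + u) ∧
      (deriv (fun r : ℝ => (f.line r : ℂ)) t = deriv (fun r : ℝ => (F.line r : ℂ)) t' ∨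
        deriv (fun r : ℝ => (f.line r : ℂ)) t = -deriv (fun r : ℝ => (F.line r : ℂ)) t') := by
    obtain ⟨r, rfl | rfl⟩ := hf
    · exact ⟨r + t, by rw [← h, mul_translation_line], Or.inl (deriv_line_mul_translation F r t)⟩
    · refine ⟨-(r + t), by rw [← h, mul_translation_line, mul_halfTurn_line], Or.inr ?_⟩
      rw [deriv_line_mul_translation, deriv_line_mul_halfTurn]
  have hcross := (line_mem_range_moebius F m (v + u)).1 ⟨t', ht'⟩
  simp only [hm, mat_zero_zero, mat_zero_one, mat_one_zero, mat_one_one] at hcross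
  have hY : Real.exp (v + u) = √(M / P) := by
    rw [eq_comm, Real.sqrt_eq_iff_eq_sq (by positivity) (by positivity), div_eq_iff hP.ne']
    have : (Real.exp (v + u) ^ 2 * P - M) * κ ^ 2 = 0 := by linarith
    rcases mul_eq_zero.1 this with h | h
    · linarith
    · exact absurd h (by positivity)
  have hratio := velocity_ratio F m ht'
  have harg := arg_sq_eq (c := κ * Real.exp (v + u)) (d := κ) (ρ := Real.exp (t' - (v + u)))
    (by positivity) hκ (by positivity)
  rw [mul_div_cancel_left₀ _ hκ.ne', hY] at harg
  have hpos : 0 < 2 * Real.arctan √(M / P) := by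
    have := Real.arctan_pos.2 (show 0 < √(M / P) by positivity)
    linarith
  have hlt : 2 * Real.arctan √(M / P) < Real.pi := by
    have := Real.arctan_lt_pi_div_two √(M / P)
    linarith
  have hmod := toIcoMod_arg hpos hlt harg
  rw [HyperbolicSurface.anticlockwiseAngle, deriv_line_mul_translation]
  have hm11 : m 1 1 = κ := rfl
  have hm10 : m 1 0 = κ := rfl
  rw [hm11, hm10, hY] at hratio
  push_cast at hmod hratio
  rcases hd with hd | hd
  · rw [hd, hratio]; exact hmod.1
  · rw [hd, neg_div, hratio]; exact hmod.2

end IsomPlus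

namespace HyperbolicSurface

open IsomPlus ClosedGeodesic

variable {G : Type*} [Group G]

/-! ### The axes in the twisted surfaces -/

/-- The closed geodesic in the class of an element whose axis is known. -/
def ofAxis {Y : HyperbolicSurface G} {a : G} {f : IsomPlus} {r : ℝ} (hr : 0 < r)
    (h : Y.hol a = f * translation r * f⁻¹) : Y.ClosedGeodesic where
  frame := f
  deck := a
  len := r
  len_pos := hr
  hol_deck_smul t := by rw [h, smul_line, inv_mul_cancel_right, mul_translation_line, add_comm]

theorem frame_eq_of_axis {Y : HyperbolicSurface G} (x' : Y.ClosedGeodesic) {f : IsomPlus} {r : ℝ}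
    (hr : 0 < r) (h : Y.hol x'.deck = f * translation r * f⁻¹) :
    ∃ v, x'.frame = f * translation v :=
  eq_mul_translation_of_conj hr x'.len_pos (h.symm.trans x'.hol_deck)

/-- If the first element translates along the geodesic of `F` and the second one acts by a positive
matrix in the coordinates of `F`, then their axes cross at a well-defined angle. -/
theorem hasAngle_iff {X Y : HyperbolicSurface G} {x y : X.ClosedGeodesic}
    (p : IntersectionPoint x y)
    {F f : IsomPlus} {r : ℝ} (hr : 0 < r) (hf : SameLine F f)
    (ha : Y.hol (p.γ * x.deck * p.γ⁻¹) = f * translation r * f⁻¹) {m : SL(2, ℝ)} (hm : Pos m)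
    (hb : Y.hol y.deck = F * moebius m * F⁻¹) (θ : ℝ) :
    p.HasAngle Y θ ↔ θ = axisAngle m := by
  obtain ⟨κ, len, hdet, hκ, hlen, hax⟩ := hm.exists_axis
  set n := mat (fixedPos m * κ) (-fixedPos (reflect m) * κ) κ κ hdet with hn
  have hP := hm.fixedPos_pos
  have hM := (pos_reflect hm).fixedPos_pos
  have hb' : Y.hol y.deck = (F * moebius n) * translation len * (F * moebius n)⁻¹ := by
    rw [hb, translation_eq, mul_inv_rev, mul_assoc F (moebius n), ← map_mul, ← hax, map_mul]
    group
  constructor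
  · rintro ⟨x', y', hx', hy', t, u, hmeet, rfl⟩
    obtain ⟨v, hv⟩ := frame_eq_of_axis x' hr (by rw [hx', ha])
    have hw := frame_eq_of_axis y' hlen (by rw [hy', hb'])
    refine anticlockwiseAngle_eq hP hM hκ hdet ?_ hw hmeet
    rw [hv]
    obtain ⟨c, rfl | rfl⟩ := hf
    · exact ⟨c + v, Or.inl (by rw [translation_add, mul_assoc])⟩
    · exact ⟨c + v, Or.inr (by rw [translation_add, mul_assoc (F * halfTurn)])⟩
  · rintro rfl
    have hcross : (F * moebius n).line (Real.log √(fixedPos (reflect m) / fixedPos m)) ∈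
        Set.range f.line := by
      rw [hf.range_eq, line_mem_range_moebius, Real.exp_log (by positivity),
        Real.sq_sqrt (by positivity)]
      simp only [hn, mat_zero_zero, mat_zero_one, mat_one_zero, mat_one_one]
      field_simp
      ring
    obtain ⟨t, ht⟩ := hcross
    exact ⟨ofAxis hr ha, ofAxis hlen hb', rfl, rfl, t, _, ht,
      (anticlockwiseAngle_eq hP hM hκ hdet hf ⟨0, by rw [translation_zero, mul_one]⟩ ht).symm⟩

section crossing

variable {X : HyperbolicSurface G} {x y : X.ClosedGeodesic}

/-- Closed geodesics with different images have no lifts in common. -/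
theorem not_sameLine_of_preimage_ne (hxy : x.preimage ≠ y.preimage) (p : IntersectionPoint x y) :
    ¬ SameLine (x.lift p.γ) y.frame := by
  intro h
  have hr := h.range_eq
  apply hxy
  ext z
  constructor
  · rintro ⟨γ, t, rfl⟩
    obtain ⟨u, hu⟩ : (x.lift p.γ).line t ∈ Set.range y.frame.line := hr ▸ ⟨t, rfl⟩
    refine ⟨γ * p.γ⁻¹, u, ?_⟩
    rw [ClosedGeodesic.lift, ClosedGeodesic.lift, ← smul_line (X.hol (γ * p.γ⁻¹)), hu, smul_line,
      ← lift_mul, inv_mul_cancel_right, ClosedGeodesic.lift]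
  · rintro ⟨γ, t, rfl⟩
    obtain ⟨u, hu⟩ : y.frame.line t ∈ Set.range (x.lift p.γ).line := hr ▸ ⟨t, rfl⟩
    refine ⟨γ * p.γ, u, ?_⟩
    rw [ClosedGeodesic.lift, ← smul_line, ← hu, smul_line, ← lift_mul]

/-- A frame of the lift of `x` at the intersection point, such that `y` passes from its left to its
right. -/
theorem exists_crossing_frame (hxy : x.preimage ≠ y.preimage) (p : IntersectionPoint x y) :
    ∃ g, (g = x.lift p.γ ∨ g = x.lift p.γ * halfTurn) ∧
      y.frame.line p.timeY ∈ Set.range g.line ∧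
      ∀ u, (u < p.timeY → y.frame.line u ∈ g.leftSide) ∧
        (p.timeY < u → y.frame.line u ∈ g.rightSide) := by
  have hmem : y.frame.line p.timeY ∈ Set.range (x.lift p.γ).line := ⟨_, p.meet⟩
  rcases sameLine_or_crossing hmem with h | h | h
  · exact absurd h (not_sameLine_of_preimage_ne hxy p)
  · exact ⟨_, Or.inl rfl, hmem, h⟩
  · refine ⟨_, Or.inr rfl, by rwa [range_line_mul_halfTurn], fun u => ?_⟩
    rw [leftSide_mul_halfTurn, rightSide_mul_halfTurn]
    exact h u

/-- A short segment of the geodesic beyond the parameter `T` does not meet the lifts. -/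
theorem exists_short_gap {k : IsomPlus} (hk : ∀ f ∈ x.frames, ¬ SameLine f k) (T : ℝ) {c : ℝ}
    (hc : 0 < c) : ∃ ε, 0 < ε ∧ ε < c ∧ ∀ v, T < v → v ≤ T + ε → k.line v ∉ x.preimage := by
  classical
  obtain ⟨e, he, h⟩ := exists_pos_le_of_finite (finite_mem_preimage hk T (T + 1))
    (fun v => if T < v then v - T else 1) fun v => by
      split_ifs with hv
      · linarith
      · exact one_pos
  have hmin : 0 < min (min e 1) c := lt_min (lt_min he one_pos) hc
  have h1 : min (min e 1) c ≤ e := (min_le_left _ _).trans (min_le_left _ _)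
  have h2 : min (min e 1) c ≤ 1 := (min_le_left _ _).trans (min_le_right _ _)
  have h3 : min (min e 1) c ≤ c := min_le_right _ _
  refine ⟨min (min e 1) c / 2, by linarith, by linarith, fun v hv1 hv2 hv => ?_⟩
  have := h v ⟨⟨hv1.le, by linarith⟩, hv⟩
  rw [if_pos hv1] at this
  linarith

/-- The lifts of `x` crossed by one period of `y` form a chain, and so the deck transformation of
`y` in the twisted surfaces is given by a word in positive matrices which do not depend on the
twist. -/
theorem exists_positive_word (hx : x.IsSimple) (hxy : x.preimage ≠ y.preimage)
    (p : IntersectionPoint x y) : ∃ (g : IsomPlus) (z₀ : x.Off) (L : List SL(2, ℝ)),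
      (g = x.lift p.γ ∨ g = x.lift p.γ * halfTurn) ∧ L ≠ [] ∧ (∀ m ∈ L, Pos m) ∧
      (∀ s, twistCocycle hx s z₀ (x.offPerm y.deck z₀) * X.hol y.deck =
        g * moebius (word s L) * g⁻¹) ∧
      ∀ s, twistCocycle hx s z₀ (x.offPerm (p.γ * x.deck * p.γ⁻¹) z₀) = 1 := by
  obtain ⟨g, hgp, hT, hcr⟩ := exists_crossing_frame hxy p
  have hg : g ∈ x.frames := ⟨p.γ, hgp⟩
  set k := y.frame with hkdef
  set T := p.timeY with hTdef
  set b := y.deck with hb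
  have hper : ∀ t, X.hol b • k.line t = k.line (t + y.len) := y.hol_deck_smul
  have hlen := y.len_pos
  have hk : ∀ f ∈ x.frames, ¬ SameLine f k := not_sameLine_of_crossing hx hg hT
    (notMem_range_of_mem_rightSide ((hcr (T + 1)).2 (by linarith)))
  obtain ⟨ε, hε, hεlen, hgap⟩ := exists_short_gap hk T hlen
  set z₀ : x.Off := ⟨k.line (T + ε), hgap _ (by linarith) le_rfl⟩ with hz₀
  have hbz : ((x.offPerm b z₀ : x.Off) : ℍ) = k.line (T + ε + y.len) := hper _
  have hz₀g : (z₀ : ℍ) ∈ g.rightSide := (hcr _).2 (by linarith)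
  -- the translate of `g` by the deck transformation of `y` is crossed one period later
  have hbg : X.hol b * g ∈ x.frames := hol_mul_mem_frames b hg
  have hcr' : ∀ u, (u < T + y.len → k.line u ∈ (X.hol b * g).leftSide) ∧
      (T + y.len < u → k.line u ∈ (X.hol b * g).rightSide) := fun u => by
    have h1 := hper (u - y.len)
    rw [sub_add_cancel] at h1
    rw [← h1, smul_mem_leftSide, smul_mem_rightSide]
    exact ⟨fun h => (hcr _).1 (by linarith), fun h => (hcr _).2 (by linarith)⟩
  have hz₀b : (z₀ : ℍ) ∈ (X.hol b * g).leftSide := (hcr' _).1 (by linarith)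
  have hbzb : ((x.offPerm b z₀ : x.Off) : ℍ) ∈ (X.hol b * g).rightSide := by
    rw [hbz]; exact (hcr' _).2 (by linarith)
  have hfirst : ∀ f ∈ x.frames, (z₀ : ℍ) ∈ f.leftSide →
      ((x.offPerm b z₀ : x.Off) : ℍ) ∈ f.rightSide → Before g f := by
    intro f hf h1 h2
    rw [hbz] at h2
    obtain ⟨v, hv1, hv2, hv3, hv4⟩ := exists_crossing (show T + ε < T + ε + y.len by linarith) h1 h2
    rcases trichotomy_of_separates hx hg hf ((hcr (T - 1)).1 (by linarith))
      ((hcr (T + ε + y.len)).2 (by linarith)) ((hv4 (T - 1)).1 (by linarith)) h2 with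
      ⟨r, rfl⟩ | h | h
    · rw [leftSide_mul_translation] at h1
      exact absurd h1 (notMem_leftSide_of_mem_rightSide hz₀g)
    · exact h
    · have h3 := (hv4 T).1 (by linarith)
      have h4 := h.mem_rightSide fun h' => notMem_range_of_mem_leftSide h' hT
      exact absurd h3 (notMem_leftSide_of_mem_rightSide h4)
  have hlast : ∀ f ∈ x.frames, (z₀ : ℍ) ∈ f.leftSide →
      ((x.offPerm b z₀ : x.Off) : ℍ) ∈ f.rightSide → ¬ Before (X.hol b * g) f := by
    intro f hf h1 h2 h
    rw [hbz] at h2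
    obtain ⟨v, hv1, hv2, hv3, -⟩ := exists_crossing (show T + ε < T + ε + y.len by linarith) h1 h2
    have h3 := h.mem_rightSide fun h' => notMem_range_of_mem_leftSide h' hv3
    have h4 : T + y.len < v := by
      by_contra! hle
      rcases hle.lt_or_eq with hlt | rfl
      · exact notMem_leftSide_of_mem_rightSide h3 ((hcr' v).1 hlt)
      · rw [← hper, smul_mem_rightSide] at h3
        exact notMem_range_of_mem_rightSide h3 hT
    refine hgap (v - y.len) (by linarith) (by linarith) ?_
    rw [← hol_smul_mem_preimage b, hper, sub_add_cancel]
    exact mem_preimage.2 ⟨f, hf, hv3⟩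
  obtain ⟨l, hl, hl2, hl3, hls⟩ := exists_chain hx z₀ (x.offPerm b z₀)
  obtain ⟨q, hq, r, hqr⟩ := hl3 _ hbg hz₀b hbzb
  obtain ⟨l₁, l₂, rfl⟩ := List.append_of_mem hq
  have hl₂ : l₂ = [] := by
    refine List.eq_nil_iff_forall_not_mem.2 fun f hf => ?_
    have hfl : f ∈ l₁ ++ q :: l₂ := by simp [hf]
    refine hlast f (hl2 f hfl).1 (hl2 f hfl).2.1 (hl2 f hfl).2.2 ?_
    rw [List.pairwise_append, List.pairwise_cons] at hl
    obtain ⟨m, hm, rfl⟩ := hl.2.1.1 f hf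
    refine ⟨diag (-r) * m, hm.diag_mul _, ?_⟩
    rw [hqr, map_mul, ← translation_eq, translation_neg]; group
  subst hl₂
  have hchain : (g :: (l₁ ++ [X.hol b * g])).Pairwise Before := by
    rw [List.pairwise_append] at hl
    rw [List.pairwise_cons, List.pairwise_append]
    refine ⟨fun f hf => ?_, hl.1, List.pairwise_singleton _ _, fun f hf f' hf' => ?_⟩
    · rw [List.mem_append, List.mem_singleton] at hf
      rcases hf with hf | rfl
      · have hfl : f ∈ l₁ ++ [q] := by simp [hf]
        exact hfirst f (hl2 f hfl).1 (hl2 f hfl).2.1 (hl2 f hfl).2.2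
      · exact hfirst _ hbg hz₀b hbzb
    · rw [List.mem_singleton] at hf'
      obtain ⟨m, hm, hfm⟩ := hl.2.2 f hf q (List.mem_singleton_self q)
      refine ⟨m * diag r, hm.mul_diag r, ?_⟩
      rw [hf', hqr, hfm, map_mul, translation_eq, mul_assoc]
  obtain ⟨L, hne, hL, hword⟩ := exists_word hchain
  refine ⟨g, z₀, L, hgp, hne, hL, fun s => ?_, fun s => ?_⟩
  · rw [eq_mul_inv_iff_mul_eq, mul_assoc, ← hword s, hls s]
    congr 1
    simp [hqr, shear_mul_translation]
  · set a := p.γ * x.deck * p.γ⁻¹ with ha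
    have hag : ∃ c, X.hol a * g = g * translation c := by
      have h1 : X.hol a = x.lift p.γ * translation x.len * (x.lift p.γ)⁻¹ := by
        rw [ha, map_mul, map_mul, x.hol_deck, map_inv, ClosedGeodesic.lift]; group
      rcases hgp with h | h
      · exact ⟨x.len, by rw [h1, h]; group⟩
      · refine ⟨-x.len, ?_⟩
        rw [h1, h, mul_assoc _ halfTurn, ← translation_mul_halfTurn]; group
    obtain ⟨c, hc⟩ := hag
    have hazg : X.hol a • (z₀ : ℍ) ∈ g.rightSide := by
      rw [← rightSide_mul_translation g c, ← hc, smul_mem_rightSide]; exact hz₀g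
    -- no lift passes between the crossing point and `z₀`
    have hno : ∀ f ∈ x.frames, k.line T ∈ f.leftSide → (z₀ : ℍ) ∈ f.rightSide → False := by
      intro f hf h1 h2
      obtain ⟨v, hv1, hv2, hv3, -⟩ := exists_crossing (show T < T + ε by linarith) h1 h2
      exact hgap v hv1 hv2.le (mem_preimage.2 ⟨f, hf, hv3⟩)
    refine twistCocycle_eq_one hx s fun f hf => ?_
    rintro ⟨h1, h2⟩
    rw [coe_offPerm] at h2
    rcases sameLine_or_before hx hg hf with h | h | h | h | h
    · obtain ⟨r, rfl | rfl⟩ := h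
      · rw [leftSide_mul_translation] at h1
        exact notMem_leftSide_of_mem_rightSide hz₀g h1
      · rw [rightSide_mul_translation, rightSide_mul_halfTurn] at h2
        exact notMem_leftSide_of_mem_rightSide hazg h2
    · have h3 : X.hol a • k.line T ∈ f.leftSide := by
        refine h.mem_leftSide fun h' => ?_
        rw [← rightSide_mul_translation g c, ← hc, smul_mem_rightSide] at h'
        exact notMem_range_of_mem_rightSide h' hT
      have hf' : X.hol a⁻¹ * f ∈ x.frames := hol_mul_mem_frames _ hf
      have hff : f = X.hol a * (X.hol a⁻¹ * f) := by rw [map_inv, mul_inv_cancel_left]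
      rw [hff, smul_mem_leftSide] at h3
      rw [hff, smul_mem_rightSide] at h2
      exact hno _ hf' h3 h2
    · refine hno _ (mul_halfTurn_mem_frames hf)
        (h.mem_leftSide fun h' => notMem_range_of_mem_rightSide h' hT) ?_
      rwa [rightSide_mul_halfTurn]
    · have := h.mem_rightSide (notMem_leftSide_of_mem_rightSide h2)
      rw [rightSide_mul_halfTurn] at this
      exact notMem_leftSide_of_mem_rightSide hazg this
    · have := h.mem_rightSide (z := (z₀ : ℍ)) (by
        rw [leftSide_mul_halfTurn]
        exact fun h' => notMem_leftSide_of_mem_rightSide h' h1)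
      rw [rightSide_mul_halfTurn] at this
      exact notMem_leftSide_of_mem_rightSide hz₀g this

/-- The angle in a twisted surface is that of a word in positive matrices. -/
theorem exists_hasAngle_iff (hx : x.IsSimple) (hxy : x.preimage ≠ y.preimage)
    (p : IntersectionPoint x y) : ∃ L : List SL(2, ℝ), L ≠ [] ∧ (∀ m ∈ L, Pos m) ∧
      ∀ (s : ℝ) (Y : HyperbolicSurface G), IsLeftTwist x s Y →
        ∀ θ, p.HasAngle Y θ ↔ θ = axisAngle (word s L) := by
  obtain ⟨g, z₀, L, hgp, hne, hL, hb, ha⟩ := exists_positive_word hx hxy p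
  refine ⟨L, hne, hL, fun s Y hY θ => ?_⟩
  obtain ⟨E, hE, hEq⟩ := exists_placement hx hY
  have hdeck : ∀ γ, Y.hol γ = E z₀ * (twistCocycle hx s z₀ (x.offPerm γ z₀) * X.hol γ) * (E z₀)⁻¹ :=
      by
    intro γ
    rw [eq_mul_inv_iff_mul_eq, ← hEq γ z₀, ← hE]
    group
  refine hasAngle_iff p (F := E z₀ * g) (f := E z₀ * x.lift p.γ) x.len_pos ?_ ?_
    (pos_word hL hne s) ?_ θ
  · rcases hgp with rfl | rfl
    · exact ⟨0, Or.inl (by simp)⟩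
    · exact ⟨0, Or.inr (by
        rw [translation_zero, mul_one, mul_assoc, mul_assoc, halfTurn_mul_halfTurn, mul_one])⟩
  · rw [hdeck, ha, one_mul, map_mul, map_mul, x.hol_deck, map_inv, ClosedGeodesic.lift]; group
  · rw [hdeck, hb]; group

end crossing

end HyperbolicSurface

end

theorem lemma2p1 {G : Type*} [Group G] (X : HyperbolicSurface G) (x y : X.ClosedGeodesic)
    (hx : x.IsSimple) (hxy : x.preimage ≠ y.preimage)
    (p : HyperbolicSurface.IntersectionPoint x y) :
    (∀ s : ℝ, ∃ Y : HyperbolicSurface G, HyperbolicSurface.IsLeftTwist x s Y) ∧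
    ∀ Xs : ℝ → HyperbolicSurface G, (∀ s : ℝ, HyperbolicSurface.IsLeftTwist x s (Xs s)) →
      (∀ s : ℝ, ∃! θ : ℝ, p.HasAngle (Xs s) θ) ∧
      ∀ φ : ℝ → ℝ, (∀ s : ℝ, p.HasAngle (Xs s) (φ s)) → StrictAnti φ := by
  obtain ⟨L, hne, hL, h⟩ := HyperbolicSurface.exists_hasAngle_iff hx hxy p
  obtain ⟨z₀⟩ := HyperbolicSurface.ClosedGeodesic.nonempty_off hx
  refine ⟨fun s => ⟨_, HyperbolicSurface.ClosedGeodesic.isLeftTwist_twist hx s z₀⟩,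
    fun Xs hXs => ⟨fun s => ⟨_, (h s _ (hXs s) _).2 rfl, fun θ hθ => (h s _ (hXs s) θ).1 hθ⟩,
      fun φ hφ s s' hs => ?_⟩⟩
  rw [(h s _ (hXs s) _).1 (hφ s), (h s' _ (hXs s') _).1 (hφ s')]
  exact IsomPlus.axisAngle_word_lt hL hne hs
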